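/- Let $\mathfrak H$ be the upper half plane, $z=x+iy\in\mathfrak H$, and $\mathbb L=\log|e^{2\pi i z}|=i\pi(z-\bar z)=-2\pi y$. Let $r,s\ge 0$ be integers with $w=r+s>0$, and let $$\mathcal E_{r,s}(z)=\frac{w!}{(2\pi i)^{w+2}}\,\frac12\sum_{(m,n)\in\mathbb Z^2\setminus\{(0,0)\}}\frac{\mathbb L}{(mz+n)^{r+1}(m\bar z+n)^{s+1}}$$ be the real analytic Eisenstein series. Write $$\partial_r=(z-\bar z)\frac{\partial}{\partial z}+r,\qquad \overline\partial_s=(\bar z-z)\frac{\partial}{\partial\bar z}+s,\qquad \Delta_{r,s}=-\overline\partial_{s-1}\partial_r+r(s-1).$$ For an integer $n$ and functions $f,g$ on $\mathfrak H$ put $\langle f,g\rangle_n=\int_{\mathcal D} f(z)\,\overline{g(z)}\,y^n\,\frac{dx\,dy}{y^2}$, where $\mathcal D=\{|z|>1,\ |\mathrm{Re}\,z|<\tfrac12\}$. Let $S_k$ be the space of holomorphic cusp forms of weight $k$ for $\mathrm{SL}_2(\mathbb Z)$ and $\overline S_k$ the space of their complex conjugates. For a function $f$ of modular weights $(r,s)$,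 i.e. $f(\gamma z)=(cz+d)^r(c\bar z+d)^sf(z)$ for all $\gamma=\begin{pmatrix}a&b\\c&d\end{pmatrix}\in\mathrm{SL}_2(\mathbb Z)$, the holomorphic projection $p^h(f)$ is the element $P\in S_{r-s}$ with $\langle f,g\rangle_r=\langle P,g\rangle_{r-s}$ for all $g\in S_{r-s}$, and the antiholomorphic projection $p^a(f)$ is the element $\overline P\in\overline S_{s-r}$ with $\langle f,\overline g\rangle_s=\langle\overline P,\overline g\rangle_{s-r}$ for all $g\in S_{s-r}$ (all the integrals with $f$ being required to converge absolutely). Then the series defining $\mathcal E_{r,s}$ converges absolutely, $\mathcal E_{r,s}$ is a $C^\infty$ function of modular weights $(r,s)$, and $$\overline{\mathcal E_{r,s}}=\mathcal E_{s,r},\qquad \Delta_{r,s}\,\mathcal E_{r,s}=-w\,\mathcal E_{r,s}.$$ Moreover both projections of $\mathcal E_{r,s}$ exist, are unique, and vanish: $p^h(\mathcal E_{r,s})=0$ and $p^a(\mathcal E_{r,s})=0$. -/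

import Mathlib

open scoped UpperHalfPlane MatrixGroups ContDiff Nat ComplexConjugate

noncomputable section

namespace RealAnalyticModular

/-- The function `𝕃 = log |q| = iπ (z - z̄) = -2π y` on the upper half plane. -/
def logAbsQ (z : ℍ) : ℂ := ((-2 * Real.pi * z.im : ℝ) : ℂ)

/-- The summand `𝕃 / ((m z + n) ^ (r + 1) (m z̄ + n) ^ (s + 1))` for `p = (m, n)`. -/
def eisensteinTerm (r s : ℕ) (z : ℍ) (p : ℤ × ℤ) : ℂ :=
  logAbsQ z / (((p.1 : ℂ) * z + p.2) ^ (r + 1) * ((p.1 : ℂ) * conj (z : ℂ) + p.2) ^ (s + 1))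

/-- The real analytic Eisenstein series `ℰ_{r,s}`, with `w = r + s`:
`w! / (2πi) ^ (w + 2) * (1 / 2) * ∑_{(m, n) ≠ (0, 0)} 𝕃 / ((m z + n)^(r + 1) (m z̄ + n)^(s + 1))`. -/
def eisenstein (r s : ℕ) (z : ℍ) : ℂ :=
  (((r + s)! : ℕ) : ℂ) / (2 * Real.pi * Complex.I) ^ (r + s + 2) * (1 / 2) *
    ∑' p : {p : ℤ × ℤ // p ≠ (0, 0)}, eisensteinTerm r s z p

/-- The extension of `f : ℍ → ℂ` to `ℂ` given by some fixed values off the upper half plane; it is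
only used through its germs at points of the upper half plane. -/
def extend (f : ℍ → ℂ) : ℂ → ℂ := fun z => f (UpperHalfPlane.ofComplex z)

/-- `f : ℍ → ℂ` is smooth as a function of the two real variables `x, y`. -/
def Smooth (f : ℍ → ℂ) : Prop := ContDiffOn ℝ ∞ (extend f) {z : ℂ | 0 < z.im}

/-- `f` transforms with weights `(r, s)` under `SL₂(ℤ)`:
`f(γ z) = (c z + d) ^ r (c z̄ + d) ^ s f(z)` for all `γ = (a, b; c, d)`. -/
def IsModularOfWeights (r s : ℤ) (f : ℍ → ℂ) : Prop :=
  ∀ (γ : SL(2, ℤ)) (z : ℍ),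
    f (γ • z) = ((γ 1 0 : ℂ) * z + (γ 1 1 : ℂ)) ^ r *
      ((γ 1 0 : ℂ) * conj (z : ℂ) + (γ 1 1 : ℂ)) ^ s * f z

/-- The Wirtinger derivative `∂/∂z = (∂/∂x - i ∂/∂y) / 2`. -/
def dz (f : ℍ → ℂ) (z : ℍ) : ℂ :=
  (fderiv ℝ (extend f) z 1 - Complex.I * fderiv ℝ (extend f) z Complex.I) / 2

/-- The Wirtinger derivative `∂/∂z̄ = (∂/∂x + i ∂/∂y) / 2`. -/
def dzbar (f : ℍ → ℂ) (z : ℍ) : ℂ :=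
  (fderiv ℝ (extend f) z 1 + Complex.I * fderiv ℝ (extend f) z Complex.I) / 2

/-- The Maass operator `∂_r = (z - z̄) ∂/∂z + r`. -/
def maass (r : ℤ) (f : ℍ → ℂ) (z : ℍ) : ℂ :=
  ((z : ℂ) - conj (z : ℂ)) * dz f z + r * f z

/-- The conjugate Maass operator `∂̄_s = (z̄ - z) ∂/∂z̄ + s`. -/
def maassBar (s : ℤ) (f : ℍ → ℂ) (z : ℍ) : ℂ :=
  (conj (z : ℂ) - (z : ℂ)) * dzbar f z + s * f z

/-- The Laplace operator in weights `(r, s)`: `Δ_{r,s} = - ∂̄_{s-1} ∂_r + r (s - 1)`. -/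
def laplace (r s : ℤ) (f : ℍ → ℂ) (z : ℍ) : ℂ :=
  - maassBar (s - 1) (maass r f) z + (r : ℂ) * ((s : ℂ) - 1) * f z

/-- The integrand `f(z) conj(g(z)) y ^ n` of the Petersson pairing. -/
def pairingIntegrand (n : ℤ) (f g : ℍ → ℂ) (z : ℍ) : ℂ :=
  f z * conj (g z) * ((z.im : ℝ) : ℂ) ^ n

/-- The integral defining the Petersson pairing converges absolutely. The measure on `ℍ` is
`dx dy / y ^ 2`, and `ModularGroup.fdo` is the domain `|z| > 1`, `|Re z| < 1 / 2`. -/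
def PairingConverges (n : ℤ) (f g : ℍ → ℂ) : Prop :=
  MeasureTheory.IntegrableOn (pairingIntegrand n f g) ModularGroup.fdo MeasureTheory.volume

/-- The Petersson pairing `⟨f, g⟩ = ∫_𝒟 f(z) conj(g(z)) y ^ n dx dy / y ^ 2`. -/
def pairing (n : ℤ) (f g : ℍ → ℂ) : ℂ :=
  ∫ z in ModularGroup.fdo, pairingIntegrand n f g z

/-- The complex conjugate of a function. -/
def conjFun (f : ℍ → ℂ) : ℍ → ℂ := fun z => conj (f z)

/-- `P ∈ S_{r-s}` is the holomorphic projection `p^h(f)` of a function `f` of weights `(r, s)`: the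
pairings of `f` with all cusp forms `g ∈ S_{r-s}` for the group `SL₂(ℤ)` converge, and `P`
represents the functional `g ↦ ⟨f, g⟩` by means of the Petersson inner product of `S_{r-s}`. -/
def IsHolomorphicProjection (r s : ℤ) (f : ℍ → ℂ) (P : CuspForm 𝒮ℒ (r - s)) : Prop :=
  ∀ g : CuspForm 𝒮ℒ (r - s),
    PairingConverges r f g ∧ pairing r f g = pairing (r - s) P g

/-- The conjugate of `P ∈ S_{s-r}` is the antiholomorphic projection `p^a(f)` of a function `f` of
weights `(r, s)`: the pairings of `f` with the conjugates of all cusp forms `g ∈ S_{s-r}` converge,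
and the conjugate of `P` represents the functional `conj g ↦ ⟨f, conj g⟩`. -/
def IsAntiholomorphicProjection (r s : ℤ) (f : ℍ → ℂ) (P : CuspForm 𝒮ℒ (s - r)) : Prop :=
  ∀ g : CuspForm 𝒮ℒ (s - r),
    PairingConverges s f (conjFun g) ∧
      pairing s f (conjFun g) = pairing (s - r) (conjFun P) (conjFun g)

end RealAnalyticModular

end

noncomputable section

namespace RealAnalyticModular

/-! Write G_{a,b} for the sum of (mz+n)^(-a) (mz̄+n)^(-b) over nonzero (m,n). Then ℰ_{r,s} is a
constant times (z - z̄) G_{r+1,s+1}, and everything reduces to G.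

Differentiation brings down a factor m, which is why a numerator m^c is carried along. The identity
(mz+n) - m(z - z̄) = mz̄+n (`latticeSum_sub`) removes it again: ∂_r sends (z - z̄) G_{r+1,s+1} to
(r+1)(z - z̄) G_{r+2,s}, and ∂̄_{s-1} returns s times the original function. The eigenvalue is
therefore -(r+1)s + r(s-1) = -(r+s). Modularity and conjugation come from reindexing the lattice by
γ and by -1.

For the projections, the same identity makes the pairing integrand a derivative. If r ≥ 1 and g ∈
S_{r-s}, then F = y^r G_{r,s+2} conj g has weights (0,2), and ∂F/∂z is a constant times y^(r-1)
G_{r+1,s+1} conj g, the integrand of ⟨ℰ_{r,s}, g⟩_r with the density y^(-2) included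
(`twoDz_imPowMulConj`). So F dz̄ is an invariant 1-form, and Stokes' theorem on the fundamental
domain gives zero: the vertical sides cancel under T, the halves of the arc cancel under S, and F
decays at the cusp (`setIntegral_twoDz_eq_zero`). If r = 0 the weight is -s ≤ 0 and there are no
cusp forms. Positivity of the Petersson product gives uniqueness; conjugation gives the
antiholomorphic case. -/

/-! ### Convergence of the lattice sums, locally uniformly in z -/

/-- The summand `m ^ c / ((m z + n) ^ a (m z̄ + n) ^ b)` for `p = (m, n)`. -/
def latticeTerm (a b c : ℕ) (z : ℂ) (p : ℤ × ℤ) : ℂ :=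
  (p.1 : ℂ) ^ c / (((p.1 : ℂ) * z + p.2) ^ a * ((p.1 : ℂ) * conj z + p.2) ^ b)

/-- The lattice sum `∑ m ^ c / ((m z + n) ^ a (m z̄ + n) ^ b)` over `(m, n) ≠ (0, 0)`. -/
def latticeSum (a b c : ℕ) (z : ℂ) : ℂ :=
  ∑' p : {p : ℤ × ℤ // p ≠ (0, 0)}, latticeTerm a b c z p

lemma conj_linear (m n : ℤ) (z : ℂ) : (m : ℂ) * conj z + n = conj ((m : ℂ) * z + n) := by simp

lemma linear_ne_zero {z : ℂ} (hz : 0 < z.im) {p : ℤ × ℤ} (hp : p ≠ (0, 0)) :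
    (p.1 : ℂ) * z + p.2 ≠ 0 := by
  intro h
  have h1 := congrArg Complex.im h
  have h2 := congrArg Complex.re h
  simp at h1 h2
  have h3 : p.1 = 0 := h1.resolve_right hz.ne'
  rw [h3] at h2
  simp at h2
  exact hp (Prod.ext h3 h2)

lemma conj_linear_ne_zero {z : ℂ} (hz : 0 < z.im) {p : ℤ × ℤ} (hp : p ≠ (0, 0)) :
    (p.1 : ℂ) * conj z + p.2 ≠ 0 := by
  rw [conj_linear]
  simpa only [ne_eq, map_eq_zero] using linear_ne_zero hz hp

/-- The open half strip `|Re z| < A`, `Im z > B`. -/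
def halfStrip (A B : ℝ) : Set ℂ := {z | |z.re| < A ∧ B < z.im}

lemma isOpen_halfStrip (A B : ℝ) : IsOpen (halfStrip A B) :=
  (isOpen_lt Complex.continuous_re.abs continuous_const).inter
    (isOpen_lt continuous_const Complex.continuous_im)

lemma convex_halfStrip (A B : ℝ) : Convex ℝ (halfStrip A B) := by
  have h1 : Convex ℝ {z : ℂ | |z.re| < A} := by
    have : {z : ℂ | |z.re| < A} = {z | -A < z.re} ∩ {z | z.re < A} := by ext; simp [abs_lt]
    rw [this]
    exact (convex_halfSpace_re_gt _).inter (convex_halfSpace_re_lt _)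
  exact h1.inter (convex_halfSpace_im_gt _)

/-- On a half strip |mz+n| ≥ ρ max(|m|,|n|) with one ρ > 0, so each term is O(max(|m|,|n|)^(c-a-b));
exponent -3 already suffices in rank two. -/
lemma exists_bound_latticeTerm {a b c : ℕ} (h : c + 3 ≤ a + b) (A : ℝ) {B : ℝ} (hB : 0 < B) :
    ∃ u : {p : ℤ × ℤ // p ≠ (0, 0)} → ℝ, Summable u ∧
      ∀ p : {p : ℤ × ℤ // p ≠ (0, 0)}, ∀ z ∈ halfStrip A B, ‖latticeTerm a b c z p‖ ≤ u p := by
  obtain ⟨ρ, hρ⟩ : ∃ ρ, ρ = EisensteinSeries.r ⟨⟨A, B⟩, hB⟩ := ⟨_, rfl⟩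
  have hρ0 : 0 < ρ := hρ ▸ EisensteinSeries.r_pos _
  let e : {p : ℤ × ℤ // p ≠ (0, 0)} → (Fin 2 → ℤ) := fun p ↦ ![p.1.1, p.1.2]
  have he : Function.Injective e := by
    rintro ⟨⟨a, b⟩, _⟩ ⟨⟨c, d⟩, _⟩ h
    have h0 := congrFun h 0
    have h1 := congrFun h 1
    simp [e] at h0 h1
    simp [h0, h1]
  refine ⟨fun p ↦ (ρ ^ (a + b))⁻¹ * ‖e p‖ ^ (-3 : ℝ), ?_, ?_⟩
  · exact ((EisensteinSeries.summable_one_div_norm_rpow (by norm_num)).comp_injective he).mul_left _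
  · rintro p z ⟨hz1, hz2⟩
    have hz : 0 < z.im := hB.trans hz2
    have hep : e p ≠ 0 := by
      intro h
      have h0 := congrFun h 0
      have h1 := congrFun h 1
      simp [e] at h0 h1
      exact p.2 (Prod.ext h0 h1)
    have hn : 1 ≤ ‖e p‖ := by
      rw [EisensteinSeries.norm_eq_max_natAbs]
      have : max ((e p) 0).natAbs ((e p) 1).natAbs ≠ 0 := by
        intro h
        apply hep
        ext i
        fin_cases i
        · simp at h ⊢; omega
        · simp at h ⊢; omega
      exact_mod_cast Nat.one_le_iff_ne_zero.mpr this
    have h1 : ρ * ‖e p‖ ≤ ‖(p.1.1 : ℂ) * z + p.1.2‖ := by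
      have h3 := EisensteinSeries.r_mul_max_le ⟨z, hz⟩ hep
      have h4 : ρ ≤ EisensteinSeries.r ⟨z, hz⟩ :=
        hρ ▸ EisensteinSeries.r_lower_bound_on_verticalStrip _ hB ⟨hz1.le, hz2.le⟩
      exact (mul_le_mul_of_nonneg_right h4 (norm_nonneg _)).trans h3
    have h2 : ‖(p.1.1 : ℂ)‖ ≤ ‖e p‖ := by
      have := EisensteinSeries.abs_le_left_of_norm p.1.2 p.1.1
      simpa [e] using this
    rw [latticeTerm, conj_linear, norm_div, norm_mul, norm_pow, norm_pow, norm_pow,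
      Complex.norm_conj, ← pow_add,
      div_le_iff₀ (pow_pos (norm_pos_iff.mpr (linear_ne_zero hz p.2)) _)]
    calc ‖(p.1.1 : ℂ)‖ ^ c ≤ ‖e p‖ ^ c := by gcongr
      _ ≤ (ρ ^ (a + b))⁻¹ * ‖e p‖ ^ (-3 : ℝ) * (ρ * ‖e p‖) ^ (a + b) := by
        rw [Real.rpow_neg (norm_nonneg _), mul_pow]
        norm_cast
        field_simp
        rw [← pow_add]
        exact pow_le_pow_right₀ hn (by omega)
      _ ≤ _ := by gcongr

lemma mem_halfStrip_self {z : ℂ} (hz : 0 < z.im) : z ∈ halfStrip (|z.re| + 1) (z.im / 2) :=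
  ⟨by linarith, by linarith⟩

lemma summable_latticeTerm {a b c : ℕ} (h : c + 3 ≤ a + b) {z : ℂ} (hz : 0 < z.im) :
    Summable fun p : {p : ℤ × ℤ // p ≠ (0, 0)} ↦ latticeTerm a b c z p := by
  obtain ⟨u, hu, hb⟩ := exists_bound_latticeTerm h (|z.re| + 1) (half_pos hz)
  exact .of_norm_bounded hu fun p ↦ hb p z (mem_halfStrip_self hz)

lemma exists_bound_latticeSum {a b c : ℕ} (h : c + 3 ≤ a + b) (A : ℝ) {B : ℝ} (hB : 0 < B) :
    ∃ C, ∀ z ∈ halfStrip A B, ‖latticeSum a b c z‖ ≤ C := by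
  obtain ⟨u, hu, hb⟩ := exists_bound_latticeTerm h A hB
  exact ⟨_, fun z hz ↦ tsum_of_norm_bounded hu.hasSum fun p ↦ hb p z hz⟩

/-! ### Termwise differentiation -/

/-- The real linear map `h ↦ α h + β h̄`, the total differential with Wirtinger derivatives
`α` and `β`. -/
def wirtingerCLM (α β : ℂ) : ℂ →L[ℝ] ℂ :=
  α • ContinuousLinearMap.id ℝ ℂ + β • (Complex.conjCLE : ℂ →L[ℝ] ℂ)

lemma wirtingerCLM_apply (α β h : ℂ) : wirtingerCLM α β h = α * h + β * conj h := by
  simp [wirtingerCLM]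

lemma norm_wirtingerCLM_le (α β : ℂ) : ‖wirtingerCLM α β‖ ≤ ‖α‖ + ‖β‖ := by
  refine ContinuousLinearMap.opNorm_le_bound _ (by positivity) fun h ↦ ?_
  rw [wirtingerCLM_apply, add_mul]
  refine (norm_add_le _ _).trans ?_
  simp

lemma _root_.HasFDerivAt.wirtinger_mul {f g : ℂ → ℂ} {α β γ δ z : ℂ}
    (hf : HasFDerivAt f (wirtingerCLM α β) z) (hg : HasFDerivAt g (wirtingerCLM γ δ) z) :
    HasFDerivAt (fun w ↦ f w * g w)
      (wirtingerCLM (α * g z + f z * γ) (β * g z + f z * δ)) z := by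
  refine (hf.mul hg).congr_fderiv ?_
  ext h
  simp [wirtingerCLM_apply]
  ring

lemma hasFDerivAt_latticeTerm (a b c : ℕ) {z : ℂ} (hz : 0 < z.im) {p : ℤ × ℤ} (hp : p ≠ (0, 0)) :
    HasFDerivAt (latticeTerm a b c · p) (wirtingerCLM (-a * latticeTerm (a + 1) b (c + 1) z p)
      (-b * latticeTerm a (b + 1) (c + 1) z p)) z := by
  have hA := linear_ne_zero hz hp
  have hB := conj_linear_ne_zero hz hp
  have hcj : HasFDerivAt (fun w : ℂ ↦ conj w) (Complex.conjCLE : ℂ →L[ℝ] ℂ) z :=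
    Complex.conjCLE.hasFDerivAt
  have h1 : HasFDerivAt (fun w : ℂ ↦ (((p.1 : ℂ) * w + p.2) ^ a)⁻¹)
      (wirtingerCLM (-a * p.1 / ((p.1 : ℂ) * z + p.2) ^ (a + 1)) 0) z := by
    have h : HasDerivAt (fun w : ℂ ↦ (((p.1 : ℂ) * w + p.2) ^ a)⁻¹)
        (-a * p.1 / ((p.1 : ℂ) * z + p.2) ^ (a + 1)) z := by
      have := ((((hasDerivAt_id z).const_mul (p.1 : ℂ)).add_const (p.2 : ℂ)).pow a).inv
        (pow_ne_zero a hA)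
      refine this.congr_deriv ?_
      -- The power rule has the truncated exponent a - 1, so a = 0 is treated apart.
      rcases a with _ | a
      · simp
      · simp
        field_simp
        ring
    refine (h.hasFDerivAt.restrictScalars ℝ).congr_fderiv ?_
    ext; simp [wirtingerCLM_apply, mul_comm]
  have h2 : HasFDerivAt (fun w : ℂ ↦ (((p.1 : ℂ) * conj w + p.2) ^ b)⁻¹)
      (wirtingerCLM 0 (-b * p.1 / ((p.1 : ℂ) * conj z + p.2) ^ (b + 1))) z := by
    have h : HasDerivAt (fun w : ℂ ↦ (((p.1 : ℂ) * w + p.2) ^ b)⁻¹)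
        (-b * p.1 / ((p.1 : ℂ) * conj z + p.2) ^ (b + 1)) (conj z) := by
      have := ((((hasDerivAt_id (conj z)).const_mul (p.1 : ℂ)).add_const (p.2 : ℂ)).pow b).inv
        (pow_ne_zero b hB)
      refine this.congr_deriv ?_
      rcases b with _ | b
      · simp
      · simp
        field_simp
        ring
    refine ((h.hasFDerivAt.restrictScalars ℝ).comp z hcj).congr_fderiv ?_
    ext; simp [wirtingerCLM_apply, mul_comm]
  have h3 := ((hasFDerivAt_const ((p.1 : ℂ) ^ c) z).congr_fderiv
    (show (0 : ℂ →L[ℝ] ℂ) = wirtingerCLM 0 0 by ext; simp [wirtingerCLM_apply])).wirtinger_mul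
      (h1.wirtinger_mul h2)
  have h4 : (latticeTerm a b c · p) = fun w ↦ (p.1 : ℂ) ^ c *
      ((((p.1 : ℂ) * w + p.2) ^ a)⁻¹ * (((p.1 : ℂ) * conj w + p.2) ^ b)⁻¹) := by
    ext w
    rw [latticeTerm, div_eq_mul_inv, mul_inv]
  rw [h4]
  refine h3.congr_fderiv ?_
  congr 1 <;>
  · simp only [latticeTerm]
    field_simp
    ring

lemma hasFDerivAt_latticeSum {a b c : ℕ} (h : c + 3 ≤ a + b) {z : ℂ} (hz : 0 < z.im) :
    HasFDerivAt (latticeSum a b c) (wirtingerCLM (-a * latticeSum (a + 1) b (c + 1) z)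
      (-b * latticeSum a (b + 1) (c + 1) z)) z := by
  obtain ⟨u, hu, hub⟩ := exists_bound_latticeTerm (a := a + 1) (b := b) (c := c + 1) (by omega)
    (|z.re| + 1) (half_pos hz)
  obtain ⟨v, hv, hvb⟩ := exists_bound_latticeTerm (a := a) (b := b + 1) (c := c + 1) (by omega)
    (|z.re| + 1) (half_pos hz)
  have hpos : ∀ w ∈ halfStrip (|z.re| + 1) (z.im / 2), 0 < w.im :=
    fun w hw ↦ (half_pos hz).trans hw.2
  have key := hasFDerivAt_tsum_of_isPreconnected (𝕜 := ℝ) ((hu.mul_left (a : ℝ)).add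
    (hv.mul_left (b : ℝ))) (isOpen_halfStrip (|z.re| + 1) (z.im / 2))
    (convex_halfStrip _ _).isPreconnected (f := fun (p : {p : ℤ × ℤ // p ≠ (0, 0)}) w ↦
      latticeTerm a b c w p)
    (fun p w hw ↦ hasFDerivAt_latticeTerm a b c (hpos w hw) p.2) (fun p w hw ↦ ?_)
    (mem_halfStrip_self hz) (summable_latticeTerm h hz) (mem_halfStrip_self hz)
  · refine key.congr_fderiv ?_
    have s1 := (summable_latticeTerm (a := a + 1) (b := b) (c := c + 1) (by omega) hz).mul_left
      (-a : ℂ)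
    have s2 := (summable_latticeTerm (a := a) (b := b + 1) (c := c + 1) (by omega) hz).mul_left
      (-b : ℂ)
    have s3 : HasSum (fun p : {p : ℤ × ℤ // p ≠ (0, 0)} ↦
        wirtingerCLM (-a * latticeTerm (a + 1) b (c + 1) z p)
          (-b * latticeTerm a (b + 1) (c + 1) z p)) _ :=
      (s1.hasSum.smul_const (ContinuousLinearMap.id ℝ ℂ)).add
        (s2.hasSum.smul_const (Complex.conjCLE : ℂ →L[ℝ] ℂ))
    rw [s3.tsum_eq, tsum_mul_left, tsum_mul_left]
    rfl
  · refine (norm_wirtingerCLM_le _ _).trans ?_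
    simp only [norm_mul, norm_neg, Complex.norm_natCast]
    gcongr
    · exact hub p w hw
    · exact hvb p w hw

lemma isOpen_im_pos : IsOpen {z : ℂ | 0 < z.im} := isOpen_lt continuous_const Complex.continuous_im

/-- Each derivative raises both c and a + b by one, so the convergence condition persists and the
induction runs over all (a, b, c) at once. -/
lemma contDiffOn_latticeSum {a b c : ℕ} (h : c + 3 ≤ a + b) :
    ContDiffOn ℝ ∞ (latticeSum a b c) {z : ℂ | 0 < z.im} := by
  rw [contDiffOn_infty]
  intro n
  induction n generalizing a b c with
  | zero =>
    exact contDiffOn_zero.mpr fun z hz ↦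
      (hasFDerivAt_latticeSum h hz).continuousAt.continuousWithinAt
  | succ n ih =>
    rw [Nat.cast_succ, contDiffOn_succ_iff_fderiv_of_isOpen isOpen_im_pos]
    refine ⟨fun z hz ↦ (hasFDerivAt_latticeSum h hz).differentiableAt.differentiableWithinAt,
      by simp, ?_⟩
    refine ContDiffOn.congr ?_ fun z hz ↦ (hasFDerivAt_latticeSum h hz).fderiv
    exact ((contDiffOn_const.mul (ih (by omega))).smul contDiffOn_const).add
      ((contDiffOn_const.mul (ih (by omega))).smul contDiffOn_const)

/-- Termwise this is (mz+n) - m(z - z̄) = mz̄+n over a common denominator. It serves both the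
Laplace equation and the primitive of the pairing integrand. -/
lemma latticeSum_sub {a b c : ℕ} (h : c + 3 ≤ a + (b + 1)) {z : ℂ} (hz : 0 < z.im) :
    latticeSum a (b + 1) c z - (z - conj z) * latticeSum (a + 1) (b + 1) (c + 1) z =
      latticeSum (a + 1) b c z := by
  rw [latticeSum, latticeSum, ← tsum_mul_left, ← (summable_latticeTerm h hz).tsum_sub
    ((summable_latticeTerm (by omega) hz).mul_left _)]
  refine tsum_congr fun p ↦ ?_
  have hA := linear_ne_zero hz p.2
  have hB := conj_linear_ne_zero hz p.2
  simp only [latticeTerm]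
  field_simp
  ring

/-! ### Modularity of the lattice sums -/

/-- The right action of `SL₂(ℤ)` on the nonzero vectors of `ℤ²`. -/
def vecMulEquiv (γ : SL(2, ℤ)) : {p : ℤ × ℤ // p ≠ (0, 0)} ≃ {p : ℤ × ℤ // p ≠ (0, 0)} :=
  Equiv.subtypeEquiv
    { toFun := fun p ↦ (p.1 * γ 0 0 + p.2 * γ 1 0, p.1 * γ 0 1 + p.2 * γ 1 1)
      invFun := fun p ↦ (p.1 * γ 1 1 - p.2 * γ 1 0, - p.1 * γ 0 1 + p.2 * γ 0 0)
      left_inv := fun p ↦ by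
        have h := γ.det_coe
        rw [Matrix.det_fin_two] at h
        ext
        · linear_combination p.1 * h
        · linear_combination p.2 * h
      right_inv := fun p ↦ by
        have h := γ.det_coe
        rw [Matrix.det_fin_two] at h
        ext
        · linear_combination p.1 * h
        · linear_combination p.2 * h }
    fun p ↦ by
      have h := γ.det_coe
      rw [Matrix.det_fin_two] at h
      refine not_congr ⟨fun h0 ↦ by simp [h0], fun h0 ↦ ?_⟩
      simp only [Equiv.coe_fn_mk, Prod.mk.injEq] at h0
      ext
      · linear_combination h0.1 * γ 1 1 - h0.2 * γ 1 0 - p.1 * h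
      · linear_combination h0.2 * γ 0 0 - h0.1 * γ 0 1 - p.2 * h

lemma coe_smul (γ : SL(2, ℤ)) (z : ℍ) :
    ((γ • z : ℍ) : ℂ) = ((γ 0 0 : ℂ) * z + γ 0 1) / ((γ 1 0 : ℂ) * z + γ 1 1) := by
  rw [UpperHalfPlane.specialLinearGroup_apply]
  simp

lemma bottom_row_ne_zero (γ : SL(2, ℤ)) : (γ 1 0, γ 1 1) ≠ ((0, 0) : ℤ × ℤ) := by
  intro h
  have h2 := γ.det_coe
  rw [Matrix.det_fin_two] at h2
  simp only [Prod.mk.injEq] at h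
  rw [h.1, h.2] at h2
  simp at h2

lemma latticeSum_smul (a b : ℕ) (γ : SL(2, ℤ)) (z : ℍ) :
    latticeSum a b 0 (γ • z : ℍ) = ((γ 1 0 : ℂ) * z + γ 1 1) ^ a *
      ((γ 1 0 : ℂ) * conj (z : ℂ) + γ 1 1) ^ b * latticeSum a b 0 z := by
  rw [latticeSum, latticeSum, ← (vecMulEquiv γ).tsum_eq (fun p ↦ latticeTerm a b 0 z p),
    ← tsum_mul_left]
  refine tsum_congr fun p ↦ ?_
  have hA := linear_ne_zero z.im_pos (bottom_row_ne_zero γ)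
  have hB := conj_linear_ne_zero z.im_pos (bottom_row_ne_zero γ)
  have e1 : (p.1.1 : ℂ) * (γ • z : ℍ) + p.1.2 = (((vecMulEquiv γ p).1.1 : ℂ) * z +
      (vecMulEquiv γ p).1.2) / ((γ 1 0 : ℂ) * z + γ 1 1) := by
    rw [coe_smul, eq_div_iff hA, add_mul, mul_assoc, div_mul_cancel₀ _ hA]
    simp [vecMulEquiv]
    ring
  have e2 : (p.1.1 : ℂ) * conj ((γ • z : ℍ) : ℂ) + p.1.2 =
      (((vecMulEquiv γ p).1.1 : ℂ) * conj (z : ℂ) +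
      (vecMulEquiv γ p).1.2) / ((γ 1 0 : ℂ) * conj (z : ℂ) + γ 1 1) := by
    simp only [conj_linear, ← map_div₀, ← e1]
  rw [latticeTerm, latticeTerm, e1, e2]
  simp only at hA hB
  rw [div_pow, div_pow]
  have h1 := linear_ne_zero z.im_pos (vecMulEquiv γ p).2
  have h2 := conj_linear_ne_zero z.im_pos (vecMulEquiv γ p).2
  field_simp

/-! ### Smoothness, modularity and conjugation of the Eisenstein series -/

/-- The constant with `ℰ_{r,s}(z) = κ (z - z̄) ∑ (m z + n) ^ (-r-1) (m z̄ + n) ^ (-s-1)`. -/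
def eisensteinConst (r s : ℕ) : ℂ :=
  (((r + s)! : ℕ) : ℂ) / (2 * Real.pi * Complex.I) ^ (r + s + 2) * (1 / 2) * (Complex.I * Real.pi)

lemma sub_conj_eq (z : ℂ) : z - conj z = 2 * Complex.I * z.im := by
  rw [Complex.sub_conj]
  push_cast
  ring

lemma logAbsQ_eq (z : ℍ) : logAbsQ z = Complex.I * Real.pi * ((z : ℂ) - conj (z : ℂ)) := by
  rw [sub_conj_eq, logAbsQ]
  push_cast
  simp only [UpperHalfPlane.coe_im]
  linear_combination (-2 * (Real.pi : ℂ) * z.im) * Complex.I_sq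

lemma eisensteinTerm_eq (r s : ℕ) (z : ℍ) (p : ℤ × ℤ) :
    eisensteinTerm r s z p = logAbsQ z * latticeTerm (r + 1) (s + 1) 0 z p := by
  simp [eisensteinTerm, latticeTerm, div_eq_mul_inv]

lemma eisenstein_eq (r s : ℕ) (z : ℍ) : eisenstein r s z =
    eisensteinConst r s * ((z : ℂ) - conj (z : ℂ)) * latticeSum (r + 1) (s + 1) 0 z := by
  simp only [eisenstein, eisensteinTerm_eq, tsum_mul_left, logAbsQ_eq, eisensteinConst, latticeSum]
  ring

lemma summable_eisensteinTerm {r s : ℕ} (h : 0 < r + s) (z : ℍ) :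
    Summable fun p : {p : ℤ × ℤ // p ≠ (0, 0)} ↦ eisensteinTerm r s z p := by
  simp only [eisensteinTerm_eq]
  exact (summable_latticeTerm (by omega) z.im_pos).mul_left _

lemma smooth_eisenstein {r s : ℕ} (h : 0 < r + s) : Smooth (eisenstein r s) := by
  have h1 : ContDiff ℝ ∞ fun z : ℂ ↦ eisensteinConst r s * (z - conj z) :=
    contDiff_const.mul (contDiff_id.sub Complex.conjCLE.contDiff)
  refine (h1.contDiffOn.mul (contDiffOn_latticeSum (a := r + 1) (b := s + 1) (c := 0)
    (by omega))).congr fun z hz ↦ ?_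
  rw [extend, eisenstein_eq, UpperHalfPlane.ofComplex_apply_of_im_pos hz]

lemma sub_conj_smul (γ : SL(2, ℤ)) (z : ℍ) :
    ((γ • z : ℍ) : ℂ) - conj ((γ • z : ℍ) : ℂ) = ((z : ℂ) - conj (z : ℂ)) /
      (((γ 1 0 : ℂ) * z + γ 1 1) * ((γ 1 0 : ℂ) * conj (z : ℂ) + γ 1 1)) := by
  have hA := linear_ne_zero z.im_pos (bottom_row_ne_zero γ)
  have hB := conj_linear_ne_zero z.im_pos (bottom_row_ne_zero γ)
  have h : (γ 0 0 : ℂ) * γ 1 1 - γ 0 1 * γ 1 0 = 1 := by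
    have h := γ.det_coe
    rw [Matrix.det_fin_two] at h
    exact_mod_cast h
  simp only at hA hB
  rw [coe_smul, map_div₀, ← conj_linear, ← conj_linear, div_sub_div _ _ hA hB]
  congr 1
  linear_combination ((z : ℂ) - conj (z : ℂ)) * h

lemma isModularOfWeights_eisenstein (r s : ℕ) : IsModularOfWeights r s (eisenstein r s) := by
  intro γ z
  have hA := linear_ne_zero z.im_pos (bottom_row_ne_zero γ)
  have hB := conj_linear_ne_zero z.im_pos (bottom_row_ne_zero γ)
  simp only at hA hB
  rw [eisenstein_eq, eisenstein_eq, sub_conj_smul, latticeSum_smul, zpow_natCast, zpow_natCast]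
  generalize (γ 1 0 : ℂ) * z + γ 1 1 = A at hA ⊢
  generalize (γ 1 0 : ℂ) * conj (z : ℂ) + γ 1 1 = B at hB ⊢
  field_simp
  ring

lemma latticeTerm_conj (a b : ℕ) (z : ℂ) (p : ℤ × ℤ) :
    conj (latticeTerm a b 0 z p) = latticeTerm b a 0 z p := by
  simp [latticeTerm, mul_comm]

lemma latticeSum_conj (a b : ℕ) (z : ℂ) : conj (latticeSum a b 0 z) = latticeSum b a 0 z := by
  rw [latticeSum, Complex.conj_tsum]
  simp only [latticeTerm_conj, latticeSum]

/-- Reindexing by (m,n) ↦ (-m,-n). The sign cancels the one that conjugation produces in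
(2πi)^(w+2). -/
lemma latticeSum_neg (a b : ℕ) (z : ℂ) :
    latticeSum a b 0 z = (-1) ^ (a + b) * latticeSum a b 0 z := by
  let e : {p : ℤ × ℤ // p ≠ (0, 0)} ≃ {p : ℤ × ℤ // p ≠ (0, 0)} :=
    (Equiv.neg (ℤ × ℤ)).subtypeEquiv fun p ↦ by
      rw [Equiv.neg_apply, ← Prod.zero_eq_mk, ne_eq, ne_eq, neg_eq_zero]
  conv_lhs => rw [latticeSum, ← e.tsum_eq (fun p ↦ latticeTerm a b 0 z p)]
  rw [latticeSum, ← tsum_mul_left]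
  refine tsum_congr fun p ↦ ?_
  have e1 : ((e p).1.1 : ℂ) * z + (e p).1.2 = -1 * ((p.1.1 : ℂ) * z + p.1.2) := by
    simp [e]; ring
  have e2 : ((e p).1.1 : ℂ) * conj z + (e p).1.2 = -1 * ((p.1.1 : ℂ) * conj z + p.1.2) := by
    simp [e]; ring
  rw [latticeTerm, latticeTerm, e1, e2, mul_pow, mul_pow, pow_add, div_eq_mul_inv, div_eq_mul_inv,
    mul_inv, mul_inv, mul_inv, mul_inv, ← inv_pow, ← inv_pow (-1 : ℂ) b, inv_neg_one]
  simp only [pow_zero]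
  ring

lemma conj_eisenstein (r s : ℕ) (z : ℍ) : conj (eisenstein r s z) = eisenstein s r z := by
  have h1 : conj (eisensteinConst r s) = (-1) ^ (s + 1 + (r + 1)) * -eisensteinConst s r := by
    have h : (-(2 * Real.pi * Complex.I)) ^ (s + r + 2) =
        (-1) ^ (s + r + 2) * (2 * (Real.pi : ℂ) * Complex.I) ^ (s + r + 2) := neg_pow _ _
    have hs : ((-1 : ℂ) ^ (s + r + 2))⁻¹ = (-1) ^ (s + r + 2) := by
      rw [← inv_pow, inv_neg_one]
    simp only [eisensteinConst, map_mul, map_div₀, map_pow, Complex.conj_I, Complex.conj_ofReal,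
      map_natCast, map_ofNat, map_one, mul_neg, neg_mul]
    rw [add_comm r s, h, div_eq_mul_inv, mul_inv, hs]
    ring
  rw [eisenstein_eq, eisenstein_eq, map_mul, map_mul, latticeSum_conj, map_sub, Complex.conj_conj,
    h1]
  conv_rhs => rw [latticeSum_neg]
  ring

/-! ### Maass operators and the Laplace equation -/

lemma extend_eventuallyEq {f : ℍ → ℂ} {F : ℂ → ℂ} (h : ∀ z : ℍ, f z = F z) (z : ℍ) :
    extend f =ᶠ[nhds (z : ℂ)] F := by
  filter_upwards [isOpen_im_pos.mem_nhds z.im_pos] with w hw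
  rw [extend, h, UpperHalfPlane.ofComplex_apply_of_im_pos hw]

lemma dz_eq {f : ℍ → ℂ} {F : ℂ → ℂ} (h : ∀ z : ℍ, f z = F z) {α β : ℂ} {z : ℍ}
    (hF : HasFDerivAt F (wirtingerCLM α β) z) : dz f z = α := by
  have := (hF.congr_of_eventuallyEq (extend_eventuallyEq h z)).fderiv
  rw [dz, this, wirtingerCLM_apply, wirtingerCLM_apply]
  simp only [map_one, Complex.conj_I]
  linear_combination (-α + β) / 2 * Complex.I_sq

lemma dzbar_eq {f : ℍ → ℂ} {F : ℂ → ℂ} (h : ∀ z : ℍ, f z = F z) {α β : ℂ} {z : ℍ}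
    (hF : HasFDerivAt F (wirtingerCLM α β) z) : dzbar f z = β := by
  have := (hF.congr_of_eventuallyEq (extend_eventuallyEq h z)).fderiv
  rw [dzbar, this, wirtingerCLM_apply, wirtingerCLM_apply]
  simp only [map_one, Complex.conj_I]
  linear_combination (α - β) / 2 * Complex.I_sq

lemma hasFDerivAt_sub_conj (z : ℂ) :
    HasFDerivAt (fun w : ℂ ↦ w - conj w) (wirtingerCLM 1 (-1)) z := by
  have hid : HasFDerivAt (fun w : ℂ ↦ w) (ContinuousLinearMap.id ℝ ℂ) z := hasFDerivAt_id z
  have hcj : HasFDerivAt (fun w : ℂ ↦ conj w) (Complex.conjCLE : ℂ →L[ℝ] ℂ) z :=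
    Complex.conjCLE.hasFDerivAt
  refine (hid.sub hcj).congr_fderiv ?_
  ext
  simp [wirtingerCLM_apply, sub_eq_add_neg]

lemma hasFDerivAt_const_wirtinger (κ z : ℂ) :
    HasFDerivAt (fun _ : ℂ ↦ κ) (wirtingerCLM 0 0) z :=
  (hasFDerivAt_const κ z).congr_fderiv (by ext; simp [wirtingerCLM_apply])

lemma hasFDerivAt_mul_latticeSum {a b : ℕ} (h : 3 ≤ a + b) (κ : ℂ) {z : ℂ} (hz : 0 < z.im) :
    HasFDerivAt (fun w ↦ κ * ((w - conj w) * latticeSum a b 0 w)) (wirtingerCLM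
      (κ * (latticeSum a b 0 z - a * (z - conj z) * latticeSum (a + 1) b 1 z))
      (κ * (-latticeSum a b 0 z - b * (z - conj z) * latticeSum a (b + 1) 1 z))) z := by
  refine ((hasFDerivAt_const_wirtinger κ z).wirtinger_mul ((hasFDerivAt_sub_conj z).wirtinger_mul
    (hasFDerivAt_latticeSum (by omega) hz))).congr_fderiv ?_
  congr 1 <;> ring

/-- Differentiating z - z̄ turns the coefficient r into r + 1, which then factors out of both terms
and leaves the left side of `latticeSum_sub`. -/
lemma maass_mul_latticeSum {r b : ℕ} (h : 0 < r + b) {f : ℍ → ℂ} {κ : ℂ}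
    (hf : ∀ z : ℍ, f z = κ * (((z : ℂ) - conj (z : ℂ)) * latticeSum (r + 1) (b + 1) 0 z)) (z : ℍ) :
    maass r f z =
      κ * (r + 1) * (((z : ℂ) - conj (z : ℂ)) * latticeSum (r + 2) b 0 z) := by
  rw [maass, dz_eq hf (hasFDerivAt_mul_latticeSum (by omega) κ z.im_pos), hf,
    ← latticeSum_sub (a := r + 1) (b := b) (c := 0) (by omega) z.im_pos]
  push_cast
  ring

lemma maassBar_mul_latticeSum {a s : ℕ} (h : 3 ≤ a + 1 + s) {f : ℍ → ℂ} {κ : ℂ}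
    (hf : ∀ z : ℍ, f z = κ * (((z : ℂ) - conj (z : ℂ)) * latticeSum (a + 1) s 0 z)) (z : ℍ) :
    maassBar (s - 1) f z =
      κ * s * (((z : ℂ) - conj (z : ℂ)) * latticeSum a (s + 1) 0 z) := by
  rw [maassBar, dzbar_eq hf (hasFDerivAt_mul_latticeSum (by omega) κ z.im_pos), hf]
  have := latticeSum_sub (a := a) (b := s) (c := 0) (by omega) z.im_pos
  push_cast
  linear_combination (-κ * s * ((z : ℂ) - conj (z : ℂ))) * this

lemma laplace_eisenstein {r s : ℕ} (h : 0 < r + s) (z : ℍ) :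
    laplace r s (eisenstein r s) z = -((r : ℂ) + s) * eisenstein r s z := by
  have h1 : ∀ z : ℍ, eisenstein r s z = eisensteinConst r s *
      (((z : ℂ) - conj (z : ℂ)) * latticeSum (r + 1) (s + 1) 0 z) := fun z ↦ by
    rw [eisenstein_eq, mul_assoc]
  rw [laplace, maassBar_mul_latticeSum (by omega) (maass_mul_latticeSum h h1), h1]
  push_cast
  ring

/-! ### The fundamental domain as a half strip -/

open MeasureTheory Set Filter Topology

/-- The height of the unit circle over `x`. -/
def arc (x : ℝ) : ℝ := √(1 - x ^ 2)

/-- The derivative of `arc`. -/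
def arcDeriv (x : ℝ) : ℝ := -x / arc x

lemma one_sub_sq_pos {x : ℝ} (hx : |x| < 1) : 0 < 1 - x ^ 2 := by
  have := (sq_lt_one_iff_abs_lt_one x).mpr hx
  linarith

lemma arc_pos {x : ℝ} (hx : |x| < 1) : 0 < arc x := Real.sqrt_pos.mpr (one_sub_sq_pos hx)

lemma arc_sq {x : ℝ} (hx : |x| < 1) : arc x ^ 2 = 1 - x ^ 2 := Real.sq_sqrt (one_sub_sq_pos hx).le

lemma measurable_arc : Measurable arc := by unfold arc; fun_prop

lemma continuous_arc : Continuous arc := by unfold arc; fun_prop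

lemma arc_neg (x : ℝ) : arc (-x) = arc x := by simp [arc]

lemma arcDeriv_neg (x : ℝ) : arcDeriv (-x) = -arcDeriv x := by
  simp [arcDeriv, arc_neg, neg_div]

lemma hasDerivAt_arc {x : ℝ} (hx : |x| < 1) : HasDerivAt arc (arcDeriv x) x := by
  have h := ((hasDerivAt_pow 2 x).const_sub 1).sqrt (one_sub_sq_pos hx).ne'
  refine h.congr_deriv ?_
  have := (arc_pos hx).ne'
  rw [arcDeriv, arc] at *
  field_simp
  simp

lemma differentiableAt_arcDeriv {x : ℝ} (hx : |x| < 1) : DifferentiableAt ℝ arcDeriv x :=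
  differentiableAt_id.neg.div (hasDerivAt_arc hx).differentiableAt (arc_pos hx).ne'

lemma abs_arcDeriv_le {x : ℝ} (hx : |x| ≤ 1 / 2) : |arcDeriv x| ≤ 1 := by
  have h1 : |x| < 1 := hx.trans_lt (by norm_num)
  rw [arcDeriv, abs_div, abs_neg, abs_of_pos (arc_pos h1), div_le_one (arc_pos h1)]
  refine abs_le_of_sq_le_sq' ?_ (arc_pos h1).le |> fun h ↦ abs_le.mpr h
  rw [arc_sq h1]
  have := sq_le_sq' (by linarith [abs_le.mp hx]) (abs_le.mp hx).2
  linarith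

/-- The chart `(x, t) ↦ x + i (√(1 - x²) + t)`, which maps the half strip `|x| < 1 / 2`, `t > 0` to
the standard fundamental domain. -/
def fdoChart : ℝ × ℝ ≃ᵐ ℂ where
  toFun p := ⟨p.1, arc p.1 + p.2⟩
  invFun z := (z.re, z.im - arc z.re)
  left_inv p := by simp
  right_inv z := by simp
  measurable_toFun := by
    have h : Measurable fun p : ℝ × ℝ ↦ (p.1, arc p.1 + p.2) :=
      measurable_fst.prodMk ((measurable_arc.comp measurable_fst).add measurable_snd)
    exact Complex.measurableEquivRealProd.symm.measurable.comp h
  measurable_invFun := Complex.measurable_re.prodMk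
    (Complex.measurable_im.sub (measurable_arc.comp Complex.measurable_re))

lemma fdoChart_re (p : ℝ × ℝ) : (fdoChart p).re = p.1 := rfl

lemma fdoChart_im (p : ℝ × ℝ) : (fdoChart p).im = arc p.1 + p.2 := rfl

lemma fdoChart_eq (p : ℝ × ℝ) :
    fdoChart p = (p.1 : ℂ) + Complex.I * ((arc p.1 + p.2 : ℝ) : ℂ) := by
  apply Complex.ext <;> simp [fdoChart_re, fdoChart_im]

/-- A shear: every vertical line is merely translated. -/
lemma measurePreserving_fdoChart : MeasurePreserving fdoChart := by
  have h : MeasurePreserving (fun p : ℝ × ℝ ↦ (p.1, arc p.1 + p.2))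
      (volume.prod volume) (volume.prod volume) :=
    (MeasurePreserving.id volume).skew_product (g := fun x t ↦ arc x + t)
      ((measurable_arc.comp measurable_fst).add measurable_snd)
      (ae_of_all _ fun x ↦ map_add_left_eq_self volume (arc x))
  exact (Complex.volume_preserving_equiv_real_prod.symm _).comp h

lemma image_coe_fdo : (UpperHalfPlane.coe '' ModularGroup.fdo) =
    {z : ℂ | 0 < z.im ∧ 1 < Complex.normSq z ∧ |z.re| < 1 / 2} := by
  ext z
  constructor
  · rintro ⟨τ, h, rfl⟩
    exact ⟨τ.im_pos, h⟩
  · rintro ⟨h1, h2⟩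
    exact ⟨⟨z, h1⟩, h2, rfl⟩

lemma fdoChart_preimage : fdoChart ⁻¹' (UpperHalfPlane.coe '' ModularGroup.fdo) =
    Ioo (-(1 / 2)) (1 / 2) ×ˢ Ioi 0 := by
  ext ⟨x, t⟩
  rw [image_coe_fdo]
  simp only [mem_preimage, mem_ofPred_eq, fdoChart_re, fdoChart_im, Complex.normSq_apply, mem_prod,
    mem_Ioo, mem_Ioi, ← abs_lt]
  constructor
  · rintro ⟨h1, h2, h3⟩
    refine ⟨h3, ?_⟩
    have h4 : |x| < 1 := h3.trans (by norm_num)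
    have := arc_sq h4
    have := arc_pos h4
    nlinarith
  · rintro ⟨h3, ht⟩
    have h4 : |x| < 1 := h3.trans (by norm_num)
    have := arc_sq h4
    have := arc_pos h4
    exact ⟨by linarith, by nlinarith, h3⟩

lemma measurableSet_fdo : MeasurableSet ModularGroup.fdo := by
  have h1 : Measurable fun z : ℍ ↦ Complex.normSq (z : ℂ) :=
    Complex.continuous_normSq.measurable.comp UpperHalfPlane.measurable_coe
  have h2 : Measurable fun z : ℍ ↦ |z.re| :=
    (Complex.measurable_re.comp UpperHalfPlane.measurable_coe).abs
  exact (measurableSet_lt measurable_const h1).inter (measurableSet_lt h2 measurable_const)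

/-- The integrand on `ℂ` obtained from a function on `ℍ` and the density of the measure. -/
def densityMul (h : ℍ → ℂ) (z : ℂ) : ℂ := ((1 / z.im) ^ 2 : ℝ) * h (UpperHalfPlane.ofComplex z)

lemma measurable_density : Measurable fun z : ℍ ↦
    ((1 / NNReal.mk z.im z.im_pos.le : NNReal) ^ 2) := by
  have : Measurable fun z : ℍ ↦ NNReal.mk z.im z.im_pos.le :=
    (UpperHalfPlane.continuous_im.subtype_mk _).measurable
  exact (measurable_const.div this).pow_const 2

lemma density_smul_eq (h : ℍ → ℂ) (z : ℍ) :
    ((1 / NNReal.mk z.im z.im_pos.le : NNReal) ^ 2) • h z = densityMul h z := by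
  rw [densityMul, UpperHalfPlane.ofComplex_apply, NNReal.smul_def, Complex.real_smul]
  simp

lemma measurePreserving_coe : MeasurePreserving UpperHalfPlane.coe
    (volume.comap UpperHalfPlane.coe) (volume.restrict (range UpperHalfPlane.coe)) :=
  ⟨UpperHalfPlane.measurable_coe, by rw [UpperHalfPlane.measurableEmbedding_coe.map_comap]⟩

lemma restrict_range_restrict_image (s : Set ℍ) :
    (volume.restrict (range UpperHalfPlane.coe)).restrict (UpperHalfPlane.coe '' s) =
      volume.restrict (UpperHalfPlane.coe '' s) := by
  rw [Measure.restrict_restrict' UpperHalfPlane.measurableEmbedding_coe.measurableSet_range,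
    inter_eq_self_of_subset_left (image_subset_range _ _)]

lemma setIntegral_fdo_eq (h : ℍ → ℂ) : ∫ z in ModularGroup.fdo, h z =
    ∫ p in Ioo (-(1 / 2)) (1 / 2) ×ˢ Ioi 0, densityMul h (fdoChart p) := by
  rw [← fdoChart_preimage, measurePreserving_fdoChart.setIntegral_preimage_emb
    fdoChart.measurableEmbedding (densityMul h), ← restrict_range_restrict_image,
    measurePreserving_coe.setIntegral_image_emb UpperHalfPlane.measurableEmbedding_coe
    (densityMul h), UpperHalfPlane.volume_def,
    setIntegral_withDensity_eq_setIntegral_smul measurable_density _ measurableSet_fdo]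
  simp only [density_smul_eq]

lemma integrableOn_fdo_iff (h : ℍ → ℂ) : IntegrableOn h ModularGroup.fdo ↔
    IntegrableOn (fun p ↦ densityMul h (fdoChart p)) (Ioo (-(1 / 2)) (1 / 2) ×ˢ Ioi 0) := by
  have h1 := measurePreserving_fdoChart.integrableOn_comp_preimage
    fdoChart.measurableEmbedding (f := densityMul h) (s := UpperHalfPlane.coe '' ModularGroup.fdo)
  rw [fdoChart_preimage] at h1
  refine Iff.trans ?_ h1.symm
  rw [IntegrableOn, IntegrableOn, ← restrict_range_restrict_image,
    ← IntegrableOn, ← IntegrableOn,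
    measurePreserving_coe.integrableOn_image UpperHalfPlane.measurableEmbedding_coe,
    IntegrableOn, UpperHalfPlane.volume_def, restrict_withDensity measurableSet_fdo,
    integrable_withDensity_iff_integrable_smul measurable_density, IntegrableOn]
  simp only [density_smul_eq, Function.comp_def]

lemma volume_fdo_lt_top : volume ModularGroup.fdo < ⊤ := by
  have h1 : IntegrableOn (fun _ : ℍ ↦ (1 : ℂ)) ModularGroup.fdo := by
    rw [integrableOn_fdo_iff]
    -- For |x| < 1/2 the arc lies above height 1/2, so y^(-2) ≤ (t + 1/2)^(-2).
    have h2 : IntegrableOn (fun p : ℝ × ℝ ↦ ((p.2 + 1 / 2) ^ (-2 : ℝ)))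
        (Ioo (-(1 / 2)) (1 / 2) ×ˢ Ioi 0) := by
      have h3 : IntegrableOn (fun t : ℝ ↦ (t + 1 / 2) ^ (-2 : ℝ)) (Ioi 0) :=
        integrableOn_add_rpow_Ioi_of_lt (by norm_num) (by norm_num)
      have h4 : IntegrableOn (fun _ : ℝ ↦ (1 : ℝ)) (Ioo (-(1 / 2)) (1 / 2)) :=
        integrableOn_const (by simp)
      have := h4.mul_prod h3
      rw [IntegrableOn, Measure.volume_eq_prod, ← Measure.prod_restrict]
      simpa using this
    refine Integrable.mono' h2 ?_ ?_
    · refine Measurable.aestronglyMeasurable ?_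
      simp only [densityMul, mul_one, fdoChart_im]
      exact Complex.measurable_ofReal.comp ((measurable_const.div
        ((measurable_arc.comp measurable_fst).add measurable_snd)).pow_const 2)
    · refine (ae_restrict_iff' (measurableSet_Ioo.prod measurableSet_Ioi)).mpr (ae_of_all _ ?_)
      rintro ⟨x, t⟩ ⟨hx, ht⟩
      simp only [mem_Ioi, mem_Ioo, ← abs_lt] at hx ht
      have h4 : |x| < 1 := hx.trans (by norm_num)
      have h5 := arc_sq h4
      have h6 := arc_pos h4
      have h7 : 1 / 2 ≤ arc x := by nlinarith [sq_abs x, abs_nonneg x]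
      simp only [densityMul, mul_one, fdoChart_im, Complex.norm_real, Real.norm_eq_abs]
      rw [abs_of_nonneg (by positivity), Real.rpow_neg (by positivity), one_div, inv_pow]
      norm_cast
      exact inv_anti₀ (by positivity) (pow_le_pow_left₀ (by positivity) (by linarith) 2)
  rw [IntegrableOn, integrable_const_iff] at h1
  simpa [isFiniteMeasure_restrict, lt_top_iff_ne_top] using h1

lemma hasFDerivAt_fdoChart {p : ℝ × ℝ} (hp : |p.1| < 1) :
    HasFDerivAt fdoChart (Complex.ofRealCLM.comp (ContinuousLinearMap.fst ℝ ℝ ℝ) +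
      Complex.I • Complex.ofRealCLM.comp (arcDeriv p.1 • ContinuousLinearMap.fst ℝ ℝ ℝ +
        ContinuousLinearMap.snd ℝ ℝ ℝ)) p := by
  have h1 : HasFDerivAt (fun q : ℝ × ℝ ↦ arc q.1 + q.2)
      (arcDeriv p.1 • ContinuousLinearMap.fst ℝ ℝ ℝ + ContinuousLinearMap.snd ℝ ℝ ℝ) p :=
    ((hasDerivAt_arc hp).comp_hasFDerivAt p hasFDerivAt_fst).add hasFDerivAt_snd
  have h2 : (fdoChart : ℝ × ℝ → ℂ) = fun q ↦ Complex.ofRealCLM q.1 +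
      Complex.I • Complex.ofRealCLM (arc q.1 + q.2) := by
    ext1 q
    simp [fdoChart_eq]
  rw [h2]
  exact (Complex.ofRealCLM.hasFDerivAt.comp p hasFDerivAt_fst).add
    ((Complex.ofRealCLM.hasFDerivAt.comp p h1).const_smul Complex.I)

lemma continuous_fdoChart : Continuous fdoChart := by
  have : (fdoChart : ℝ × ℝ → ℂ) = fun q ↦ (q.1 : ℂ) + Complex.I * ((arc q.1 + q.2 : ℝ) : ℂ) := by
    ext1 q
    simp [fdoChart_eq]
  have h := continuous_arc
  rw [this]
  fun_prop

/-! ### Stokes' theorem on the fundamental domain -/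

/-- Twice the Wirtinger derivative `∂F/∂z`. -/
def twoDz (F : ℂ → ℂ) (z : ℂ) : ℂ := fderiv ℝ F z 1 - Complex.I * fderiv ℝ F z Complex.I

lemma continuousOn_twoDz {F : ℂ → ℂ} (hF : ContDiffOn ℝ 1 F {z : ℂ | 0 < z.im}) :
    ContinuousOn (twoDz F) {z : ℂ | 0 < z.im} := by
  have h := hF.continuousOn_fderiv_of_isOpen isOpen_im_pos le_rfl
  exact (h.clm_apply continuousOn_const).sub
    (continuousOn_const.mul (h.clm_apply continuousOn_const))

lemma fdoChart_im_pos {p : ℝ × ℝ} (hx : |p.1| ≤ 1 / 2) (ht : 0 ≤ p.2) : 0 < (fdoChart p).im := by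
  rw [fdoChart_im]
  have := arc_pos (hx.trans_lt (by norm_num))
  positivity

/-- Along the arc the integrand is i F dz̄. On the unit circle z ↦ -1/z is the reflection x ↦ -x, so
invariance of F dz̄ makes the integrand odd in x. -/
lemma integral_arc_eq_zero {F : ℂ → ℂ}
    (hS : ∀ z : ℂ, 0 < z.im → F (-z⁻¹) = conj z ^ 2 * F z) :
    ∫ x in (-(1 / 2) : ℝ)..(1 / 2), ((arcDeriv x : ℂ) + Complex.I) * F (fdoChart (x, 0)) = 0 := by
  set h : ℝ → ℂ := fun x ↦ ((arcDeriv x : ℂ) + Complex.I) * F (fdoChart (x, 0)) with h_def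
  have hodd : ∀ x ∈ uIcc (-(1 / 2) : ℝ) (1 / 2), h (-x) = -h x := by
    intro x hx
    rw [uIcc_of_le (by norm_num), mem_Icc, ← abs_le] at hx
    have h1 : |x| < 1 := hx.trans_lt (by norm_num)
    have h2 : (arc x : ℂ) ≠ 0 := mod_cast (arc_pos h1).ne'
    have h3 : (arc x : ℂ) ^ 2 = 1 - x ^ 2 := mod_cast arc_sq h1
    have h4 : fdoChart (-x, 0) = -(fdoChart (x, 0))⁻¹ := by
      have h5 : fdoChart (x, 0) * fdoChart (-x, 0) = -1 := by
        simp only [fdoChart_eq, arc_neg, add_zero]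
        push_cast
        linear_combination (arc x : ℂ) ^ 2 * Complex.I_sq - h3
      have h6 : fdoChart (x, 0) ≠ 0 := by
        intro h0
        rw [h0] at h5
        simp at h5
      field_simp
      linear_combination h5
    simp only [h_def]
    rw [h4, hS _ (fdoChart_im_pos hx le_rfl), arcDeriv_neg, fdoChart_eq, arcDeriv]
    simp only [add_zero, map_add, map_mul, Complex.conj_I, Complex.conj_ofReal]
    push_cast
    generalize F _ = W
    field_simp
    generalize (arc x : ℂ) = a at *
    generalize (x : ℂ) = y at *
    linear_combination (norm := (ring_nf; simp only [Complex.I_sq, Complex.I_pow_three]; ring_nf))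
      (W * y - a * W * Complex.I) * h3
  have e1 : ∫ x in (-(1 / 2) : ℝ)..(1 / 2), h (-x) = ∫ x in (-(1 / 2) : ℝ)..(1 / 2), h x := by
    rw [intervalIntegral.integral_comp_neg, neg_neg]
  rw [intervalIntegral.integral_congr hodd, intervalIntegral.integral_neg] at e1
  exact self_eq_neg.mp e1.symm

lemma setIntegral_twoDz_rect {F : ℂ → ℂ} (hF : ContDiffOn ℝ 1 F {z : ℂ | 0 < z.im})
    (hT : ∀ z : ℂ, 0 < z.im → F (z + 1) = F z)
    (hS : ∀ z : ℂ, 0 < z.im → F (-z⁻¹) = conj z ^ 2 * F z) {T : ℝ} (hT0 : 0 ≤ T) :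
    ∫ p in Icc (-(1 / 2)) (1 / 2) ×ˢ Icc 0 T, twoDz F (fdoChart p) =
      -∫ x in (-(1 / 2) : ℝ)..(1 / 2), ((arcDeriv x : ℂ) + Complex.I) * F (fdoChart (x, T)) := by
  set σ' : ℝ × ℝ → ℝ × ℝ →L[ℝ] ℂ := fun p ↦
    Complex.ofRealCLM.comp (ContinuousLinearMap.fst ℝ ℝ ℝ) +
      Complex.I • Complex.ofRealCLM.comp (arcDeriv p.1 • ContinuousLinearMap.fst ℝ ℝ ℝ +
        ContinuousLinearMap.snd ℝ ℝ ℝ) with hσ'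
  set f' : ℝ × ℝ → ℝ × ℝ →L[ℝ] ℂ := fun p ↦ (fderiv ℝ F (fdoChart p)).comp (σ' p) with hf'
  -- In the chart, ∂/∂x of the pullback is F_x + arc' F_y and ∂/∂t is F_y. Hence the field (F, qF)
  -- with q = -(arc' + i) has divergence F_x - i F_y, and q does not depend on t.
  set q : ℝ × ℝ → ℂ := fun p ↦ -((arcDeriv p.1 : ℂ) + Complex.I) with hq
  set q' : ℝ × ℝ → ℝ × ℝ →L[ℝ] ℂ := fun p ↦
    -Complex.ofRealCLM.comp (deriv arcDeriv p.1 • ContinuousLinearMap.fst ℝ ℝ ℝ) with hq'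
  have hbox : ∀ p ∈ Icc ((-(1 / 2), 0) : ℝ × ℝ) (1 / 2, T), |p.1| ≤ 1 / 2 ∧ 0 ≤ p.2 := by
    rintro ⟨x, t⟩ ⟨h1, h2⟩
    exact ⟨abs_le.mpr ⟨h1.1, h2.1⟩, h1.2⟩
  have hmaps : MapsTo fdoChart (Icc ((-(1 / 2), 0) : ℝ × ℝ) (1 / 2, T)) {z : ℂ | 0 < z.im} :=
    fun p hp ↦ fdoChart_im_pos (hbox p hp).1 (hbox p hp).2
  have hcF : ContinuousOn (fun p ↦ F (fdoChart p)) (Icc ((-(1 / 2), 0) : ℝ × ℝ) (1 / 2, T)) :=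
    hF.continuousOn.comp continuous_fdoChart.continuousOn hmaps
  have hcq : ContinuousOn q (Icc ((-(1 / 2), 0) : ℝ × ℝ) (1 / 2, T)) := by
    intro p hp
    have h1 : ContinuousAt arcDeriv p.1 :=
      (differentiableAt_arcDeriv ((hbox p hp).1.trans_lt (by norm_num))).continuousAt
    have h2 : ContinuousAt (fun p : ℝ × ℝ ↦ arcDeriv p.1) p :=
      ContinuousAt.comp (f := Prod.fst) h1 continuousAt_fst
    exact (((Complex.continuous_ofReal.continuousAt.comp h2).add
      continuousAt_const).neg).continuousWithinAt
  have hf : ∀ p ∈ Icc ((-(1 / 2), 0) : ℝ × ℝ) (1 / 2, T),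
      HasFDerivAt (fun p ↦ F (fdoChart p)) (f' p) p := by
    intro p hp
    have h1 : HasFDerivAt F (fderiv ℝ F (fdoChart p)) (fdoChart p) :=
      ((hF.differentiableOn one_ne_zero _ (hmaps hp)).differentiableAt
        (isOpen_im_pos.mem_nhds (hmaps hp))).hasFDerivAt
    exact h1.comp p (hasFDerivAt_fdoChart ((hbox p hp).1.trans_lt (by norm_num)))
  have hqd : ∀ p ∈ Icc ((-(1 / 2), 0) : ℝ × ℝ) (1 / 2, T), HasFDerivAt q (q' p) p := by
    intro p hp
    have h1 := (differentiableAt_arcDeriv ((hbox p hp).1.trans_lt (by norm_num))).hasDerivAt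
    have h2 : HasFDerivAt (fun p : ℝ × ℝ ↦ arcDeriv p.1)
        (deriv arcDeriv p.1 • ContinuousLinearMap.fst ℝ ℝ ℝ) p :=
      h1.comp_hasFDerivAt p hasFDerivAt_fst
    exact ((Complex.ofRealCLM.hasFDerivAt.comp p h2).add_const Complex.I).neg
  have hdiv : ∀ p, f' p (1, 0) + (q p • f' p + F (fdoChart p) • q' p) (0, 1) =
      twoDz F (fdoChart p) := by
    intro p
    have e1 : σ' p (1, 0) = (1 : ℝ) • (1 : ℂ) + arcDeriv p.1 • Complex.I := by
      simp [hσ', mul_comm]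
    have e2 : σ' p (0, 1) = Complex.I := by simp [hσ']
    have e3 : q' p (0, 1) = 0 := by simp [hq']
    simp only [hf', add_apply, smul_apply,
      ContinuousLinearMap.comp_apply, e1, e2, e3, map_add, map_smul, hq, twoDz]
    simp only [Complex.real_smul, smul_eq_mul]
    push_cast
    ring
  have hsub : Ioo (-(1 / 2) : ℝ) (1 / 2) ×ˢ Ioo (0 : ℝ) T ⊆
      Icc ((-(1 / 2), 0) : ℝ × ℝ) (1 / 2, T) := fun p hp ↦
    ⟨⟨hp.1.1.le, hp.2.1.le⟩, ⟨hp.1.2.le, hp.2.2.le⟩⟩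
  have key := integral_divergence_prod_Icc_of_hasFDerivAt_of_le (fun p ↦ F (fdoChart p))
    (fun p ↦ q p * F (fdoChart p)) f' (fun p ↦ q p • f' p + F (fdoChart p) • q' p)
    (-(1 / 2), 0) (1 / 2, T) ⟨by norm_num, hT0⟩ hcF (hcq.mul hcF)
    (fun p hp ↦ hf p (hsub hp)) (fun p hp ↦ (hqd p (hsub hp)).mul (hf p (hsub hp))) (by
      simp only [hdiv]
      exact ((continuousOn_twoDz hF).comp continuous_fdoChart.continuousOn
        hmaps).integrableOn_compact isCompact_Icc)
  simp only [hdiv] at key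
  have hper : ∀ t ∈ uIcc 0 T, F (fdoChart (1 / 2, t)) = F (fdoChart (-(1 / 2), t)) := by
    intro t ht
    rw [uIcc_of_le hT0] at ht
    rw [← hT (fdoChart (-(1 / 2), t)) (fdoChart_im_pos (by norm_num [abs_of_pos]) ht.1)]
    congr 1
    rw [fdoChart_eq, fdoChart_eq]
    simp only [arc_neg]
    push_cast
    ring
  rw [Icc_prod_Icc, key, intervalIntegral.integral_congr hper]
  simp only [hq, neg_mul, intervalIntegral.integral_neg, integral_arc_eq_zero hS]
  ring

/-- Exhaust the half strip by rectangles of height n; only the top edge contributes, and it tends to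
0 with F. -/
lemma setIntegral_twoDz_eq_zero {F : ℂ → ℂ} (hF : ContDiffOn ℝ 1 F {z : ℂ | 0 < z.im})
    (hT : ∀ z : ℂ, 0 < z.im → F (z + 1) = F z)
    (hS : ∀ z : ℂ, 0 < z.im → F (-z⁻¹) = conj z ^ 2 * F z)
    (hdecay : ∀ ε > 0, ∃ Y : ℝ, ∀ z : ℂ, |z.re| ≤ 1 / 2 → Y ≤ z.im → ‖F z‖ ≤ ε)
    (hint : IntegrableOn (fun p ↦ twoDz F (fdoChart p)) (Ioo (-(1 / 2)) (1 / 2) ×ˢ Ioi 0)) :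
    ∫ p in Ioo (-(1 / 2)) (1 / 2) ×ˢ Ioi 0, twoDz F (fdoChart p) = 0 := by
  have hae : (Ioo (-(1 / 2)) (1 / 2) ×ˢ Ioi 0 : Set (ℝ × ℝ)) =ᵐ[volume]
      (Icc (-(1 / 2)) (1 / 2) ×ˢ Ici 0 : Set (ℝ × ℝ)) := by
    rw [Measure.volume_eq_prod]
    exact Measure.set_prod_ae_eq Ioo_ae_eq_Icc Ioi_ae_eq_Ici
  rw [setIntegral_congr_set hae]
  rw [integrableOn_congr_set_ae hae] at hint
  have hU : (Icc (-(1 / 2)) (1 / 2) ×ˢ Ici 0 : Set (ℝ × ℝ)) =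
      ⋃ n : ℕ, Icc (-(1 / 2)) (1 / 2) ×ˢ Icc (0 : ℝ) n := by
    rw [← prod_iUnion]
    congr 1
    ext t
    simp only [mem_Ici, mem_iUnion, mem_Icc, exists_and_left]
    exact ⟨fun h ↦ ⟨h, exists_nat_ge t⟩, fun h ↦ h.1⟩
  rw [hU] at hint ⊢
  have hlim := tendsto_setIntegral_of_monotone
    (fun n : ℕ ↦ measurableSet_Icc.prod measurableSet_Icc)
    (fun m n hmn ↦ prod_mono le_rfl (Icc_subset_Icc_right (by exact_mod_cast hmn))) hint
  refine tendsto_nhds_unique hlim ?_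
  rw [Metric.tendsto_atTop]
  intro ε hε
  -- With |arc' + i| ≤ 2 and an edge of length 1, this makes the integral at most ε/2 < ε.
  obtain ⟨Y, hY⟩ := hdecay (ε / 4) (by positivity)
  obtain ⟨N, hN⟩ := exists_nat_ge Y
  refine ⟨N, fun n hn ↦ ?_⟩
  rw [setIntegral_twoDz_rect hF hT hS (Nat.cast_nonneg n), dist_zero_right, norm_neg]
  refine lt_of_le_of_lt (intervalIntegral.norm_integral_le_of_norm_le_const (C := ε / 2) ?_) ?_
  · intro x hx
    rw [uIoc_of_le (by norm_num)] at hx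
    have hx1 : |x| ≤ 1 / 2 := abs_le.mpr ⟨hx.1.le, hx.2⟩
    have h1 : ‖(arcDeriv x : ℂ) + Complex.I‖ ≤ 2 := by
      refine (norm_add_le _ _).trans ?_
      rw [Complex.norm_real, Complex.norm_I, Real.norm_eq_abs]
      linarith [abs_arcDeriv_le hx1]
    have h2 : ‖F (fdoChart (x, n))‖ ≤ ε / 4 := by
      refine hY _ hx1 ?_
      rw [fdoChart_im]
      have h3 := arc_pos (hx1.trans_lt (by norm_num))
      have h4 : (N : ℝ) ≤ n := by exact_mod_cast hn
      simp only
      linarith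
    calc _ ≤ 2 * (ε / 4) := by rw [norm_mul]; gcongr
      _ = ε / 2 := by ring
  · norm_num
    linarith

/-! ### Decay of cusp forms and integrability -/

lemma cuspForm_smul {k : ℤ} (g : CuspForm 𝒮ℒ k) (γ : SL(2, ℤ)) (z : ℍ) :
    g (γ • z) = ((γ 1 0 : ℂ) * z + γ 1 1) ^ k * g z := by
  have h : (γ : GL (Fin 2) ℝ) ∈ 𝒮ℒ := ⟨γ, rfl⟩
  have := SlashInvariantForm.slash_action_eqn'' g h z
  rw [ModularGroup.sl_moeb, this, ModularGroup.denom_apply]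

/-- Exponential decay at the cusp beats every power of y, and the rest of the domain is compact. -/
lemma exists_bound_im_pow_mul_cuspForm {k : ℤ} (g : CuspForm 𝒮ℒ k) (N : ℕ) :
    ∃ C, ∀ z ∈ ModularGroup.fd, z.im ^ N * ‖g z‖ ≤ C := by
  have hg : Continuous g := (ModularFormClass.holo g).continuous
  obtain ⟨c, hc, hO⟩ := ModularFormClass.exp_decay_atImInfty' g (CuspFormClass.zero_at_infty g)
  have h1 : (fun z : ℍ ↦ z.im ^ N) =O[UpperHalfPlane.atImInfty] fun z ↦ Real.exp (c * z.im) :=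
    ((isLittleO_pow_exp_pos_mul_atTop N hc).isBigO).comp_tendsto tendsto_comap
  have h2 : (fun z : ℍ ↦ ((z.im ^ N : ℝ) : ℂ) * g z) =O[UpperHalfPlane.atImInfty]
      fun z ↦ z.im ^ (0 : ℝ) := by
    refine ((Complex.isBigO_ofReal_left.mpr h1).mul hO).congr_right fun z ↦ ?_
    rw [← Real.exp_add, Real.rpow_zero]
    simp
  obtain ⟨C, hC⟩ := ModularGroup.exists_bound_fundamental_domain_of_isBigO
    (f := fun z : ℍ ↦ ((z.im ^ N : ℝ) : ℂ) * g z)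
    ((Complex.continuous_ofReal.comp (UpperHalfPlane.continuous_im.pow N)).mul hg) h2
  refine ⟨C, fun z hz ↦ ?_⟩
  simpa [abs_of_pos z.im_pos] using hC z hz

lemma mem_halfStrip_of_mem_fd {z : ℍ} (hz : z ∈ ModularGroup.fd) : (z : ℂ) ∈ halfStrip 1 (1 / 2) :=
  ⟨hz.2.trans_lt (by norm_num), by
    have := ModularGroup.three_le_four_mul_im_sq_of_mem_fd hz
    have := z.im_pos
    rw [UpperHalfPlane.coe_im]
    nlinarith⟩

lemma continuous_latticeSum_coe {a b : ℕ} (h : 3 ≤ a + b) :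
    Continuous fun z : ℍ ↦ latticeSum a b 0 z :=
  continuous_iff_continuousAt.mpr fun z ↦
    (hasFDerivAt_latticeSum (by omega) z.im_pos).continuousAt.comp
      UpperHalfPlane.continuous_coe.continuousAt

lemma integrableOn_fdo_of_bounded {h : ℍ → ℂ} (hc : Continuous h) {C : ℝ}
    (hC : ∀ z ∈ ModularGroup.fdo, ‖h z‖ ≤ C) : IntegrableOn h ModularGroup.fdo :=
  Measure.integrableOn_of_bounded volume_fdo_lt_top.ne hc.aestronglyMeasurable
    ((ae_restrict_iff' measurableSet_fdo).mpr (ae_of_all _ hC))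

/-- The product `y ^ N · ∑ (m z + n) ^ (-a) (m z̄ + n) ^ (-b) · conj g`. -/
def imPowMulConj (N a b : ℕ) (g : ℍ → ℂ) (z : ℍ) : ℂ :=
  (z.im : ℂ) ^ N * latticeSum a b 0 z * conj (g z)

lemma integrableOn_imPowMulConj (N : ℕ) {a b : ℕ} (h : 3 ≤ a + b) {k : ℤ} (g : CuspForm 𝒮ℒ k) :
    IntegrableOn (imPowMulConj N a b g) ModularGroup.fdo := by
  obtain ⟨C, hC⟩ := exists_bound_im_pow_mul_cuspForm g N
  obtain ⟨D, hD⟩ := exists_bound_latticeSum (a := a) (b := b) (c := 0) (by omega) 1 one_half_pos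
  have hg : Continuous g := (ModularFormClass.holo g).continuous
  refine integrableOn_fdo_of_bounded (C := C * D) ?_ fun z hz ↦ ?_
  · exact (((Complex.continuous_ofReal.comp UpperHalfPlane.continuous_im).pow N).mul
      (continuous_latticeSum_coe h)).mul (Complex.continuous_conj.comp hg)
  · have hz' := ModularGroup.fdo_subset_fd hz
    have h1 := hC z hz'
    have h2 := hD z (mem_halfStrip_of_mem_fd hz')
    rw [imPowMulConj, norm_mul, norm_mul, norm_pow, Complex.norm_real, Complex.norm_conj,
      Real.norm_of_nonneg z.im_pos.le, mul_right_comm]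
    have := z.im_pos
    gcongr
    exact (by positivity : 0 ≤ z.im ^ N * ‖g z‖).trans h1

/-! ### A primitive of the pairing integrand -/

lemma hasFDerivAt_im_pow (N : ℕ) (z : ℂ) : HasFDerivAt (fun w : ℂ ↦ (w.im : ℂ) ^ (N + 1))
    (wirtingerCLM ((N + 1) * (z.im : ℂ) ^ N * (-Complex.I / 2))
      ((N + 1) * (z.im : ℂ) ^ N * (Complex.I / 2))) z := by
  have h1 : HasFDerivAt (fun w : ℂ ↦ (w.im : ℂ)) (Complex.ofRealCLM.comp Complex.imCLM) z :=
    (Complex.ofRealCLM.comp Complex.imCLM).hasFDerivAt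
  refine (h1.pow (N + 1)).congr_fderiv ?_
  ext w
  have h2 : (w.im : ℂ) = -Complex.I / 2 * (w - conj w) := by
    rw [sub_conj_eq]
    linear_combination (w.im : ℂ) * Complex.I_sq
  simp [wirtingerCLM_apply, h2]
  ring

lemma hasFDerivAt_conj_comp {g : ℂ → ℂ} {g' z : ℂ} (hg : HasDerivAt g g' z) :
    HasFDerivAt (fun w ↦ conj (g w)) (wirtingerCLM 0 (conj g')) z := by
  have h1 : HasFDerivAt (fun w ↦ Complex.conjCLE (g w)) _ z :=
    Complex.conjCLE.hasFDerivAt.comp z (hg.hasFDerivAt.restrictScalars ℝ)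
  refine h1.congr_fderiv ?_
  ext w
  simp [wirtingerCLM_apply, mul_comm]

lemma twoDz_eq {F : ℂ → ℂ} {α β z : ℂ} (hF : HasFDerivAt F (wirtingerCLM α β) z) :
    twoDz F z = 2 * α := by
  rw [twoDz, hF.fderiv, wirtingerCLM_apply, wirtingerCLM_apply]
  simp only [map_one, Complex.conj_I]
  linear_combination (-α + β) * Complex.I_sq

lemma differentiableAt_extend {k : ℤ} (g : CuspForm 𝒮ℒ k) {z : ℂ} (hz : 0 < z.im) :
    DifferentiableAt ℂ (extend g) z :=
  (UpperHalfPlane.mdifferentiable_iff.mp (ModularFormClass.holo g) z hz).differentiableAt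
    (isOpen_im_pos.mem_nhds hz)

lemma extend_imPowMulConj (N a b : ℕ) (g : ℍ → ℂ) {z : ℂ} (hz : 0 < z.im) :
    extend (imPowMulConj N a b g) z = (z.im : ℂ) ^ N * latticeSum a b 0 z * conj (extend g z) := by
  rw [extend, extend, imPowMulConj, UpperHalfPlane.ofComplex_apply_of_im_pos hz]
  rfl

/-- Since conj g is antiholomorphic, only y^(r+1) and the lattice sum are differentiated. As z - z̄
= 2iy, the two terms combine by `latticeSum_sub`. -/
lemma twoDz_imPowMulConj {r s : ℕ} (h : 0 < r + s) {k : ℤ} (g : CuspForm 𝒮ℒ k) {z : ℂ}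
    (hz : 0 < z.im) : twoDz (extend (imPowMulConj (r + 1) (r + 1) (s + 2) g)) z =
      -Complex.I * (r + 1) * densityMul (imPowMulConj (r + 2) (r + 2) (s + 1) g) z := by
  have h1 := ((hasFDerivAt_im_pow r z).wirtinger_mul (hasFDerivAt_latticeSum (a := r + 1)
    (b := s + 2) (c := 0) (by omega) hz)).wirtinger_mul
      (hasFDerivAt_conj_comp (differentiableAt_extend g hz).hasDerivAt)
  have h2 : extend (imPowMulConj (r + 1) (r + 1) (s + 2) g) =ᶠ[𝓝 z]
      fun z ↦ (z.im : ℂ) ^ (r + 1) * latticeSum (r + 1) (s + 2) 0 z * conj (extend g z) := by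
    filter_upwards [isOpen_im_pos.mem_nhds hz] with w hw using extend_imPowMulConj _ _ _ _ hw
  rw [twoDz_eq (h1.congr_of_eventuallyEq h2)]
  have h3 := extend_imPowMulConj (r + 2) (r + 2) (s + 1) g hz
  rw [extend] at h3
  rw [densityMul, h3, ← latticeSum_sub (a := r + 1) (b := s + 1) (c := 0) (by omega) hz,
    sub_conj_eq]
  have h4 : (z.im : ℂ) ≠ 0 := mod_cast hz.ne'
  push_cast
  field_simp
  linear_combination (-2 * (r + 1) * (z.im : ℂ) ^ (r + 3) *
    latticeSum (r + 1 + 1) (s + 1 + 1) (0 + 1) z * conj (extend g z)) * Complex.I_sq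

lemma contDiffOn_imPowMulConj (N : ℕ) {a b : ℕ} (h : 3 ≤ a + b) {k : ℤ} (g : CuspForm 𝒮ℒ k) :
    ContDiffOn ℝ 1 (extend (imPowMulConj N a b g)) {z : ℂ | 0 < z.im} := by
  have h1 : ContDiff ℝ 1 fun z : ℂ ↦ (z.im : ℂ) ^ N :=
    (Complex.ofRealCLM.contDiff.comp Complex.imCLM.contDiff).pow N
  have h2 : ContDiffOn ℝ 1 (latticeSum a b 0) {z : ℂ | 0 < z.im} :=
    (contDiffOn_latticeSum (by omega)).of_le (by exact_mod_cast le_top)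
  have h3 : ContDiffOn ℂ 1 (extend g) {z : ℂ | 0 < z.im} :=
    DifferentiableOn.contDiffOn
      (fun z hz ↦ (differentiableAt_extend g hz).differentiableWithinAt) isOpen_im_pos
  have h4 : ContDiffOn ℝ 1 (fun z ↦ conj (extend g z)) {z : ℂ | 0 < z.im} :=
    Complex.conjCLE.contDiff.comp_contDiffOn (h3.restrict_scalars ℝ)
  exact ((h1.contDiffOn.mul h2).mul h4).congr fun z hz ↦ extend_imPowMulConj _ _ _ _ hz

lemma im_smul (γ : SL(2, ℤ)) (z : ℍ) : ((γ • z : ℍ).im : ℂ) = z.im /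
    (((γ 1 0 : ℂ) * z + γ 1 1) * ((γ 1 0 : ℂ) * conj (z : ℂ) + γ 1 1)) := by
  have h := sub_conj_smul γ z
  rw [sub_conj_eq, sub_conj_eq, mul_div_assoc] at h
  exact mul_left_cancel₀ (by simp) h

/-- Weights add up: (-r,-r) from y^r, (r,s+t) from the sum, (0,r-s) from conj g. The case t = 2 is
what Stokes' theorem needs. -/
lemma imPowMulConj_smul (r s t : ℕ) (g : CuspForm 𝒮ℒ ((r : ℤ) - s)) (γ : SL(2, ℤ)) (z : ℍ) :
    imPowMulConj r r (s + t) g (γ • z) =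
      ((γ 1 0 : ℂ) * conj (z : ℂ) + γ 1 1) ^ t * imPowMulConj r r (s + t) g z := by
  have hA := linear_ne_zero z.im_pos (bottom_row_ne_zero γ)
  have hB := conj_linear_ne_zero z.im_pos (bottom_row_ne_zero γ)
  simp only at hA hB
  rw [imPowMulConj, imPowMulConj, im_smul, latticeSum_smul, cuspForm_smul, map_mul, map_zpow₀,
    ← conj_linear, zpow_sub₀ hB, zpow_natCast, zpow_natCast]
  generalize (γ 1 0 : ℂ) * z + γ 1 1 = A at hA ⊢
  generalize (γ 1 0 : ℂ) * conj (z : ℂ) + γ 1 1 = B at hB ⊢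
  rw [div_pow, mul_pow, pow_add]
  field_simp

lemma exists_extend_imPowMulConj_le (N : ℕ) {a b : ℕ} (h : 3 ≤ a + b) {k : ℤ}
    (g : CuspForm 𝒮ℒ k) {ε : ℝ} (hε : 0 < ε) : ∃ Y : ℝ, ∀ z : ℂ, |z.re| ≤ 1 / 2 → Y ≤ z.im →
      ‖extend (imPowMulConj N a b g) z‖ ≤ ε := by
  -- The spare power of y yields the bound CD/y, which tends to 0.
  obtain ⟨C, hC⟩ := exists_bound_im_pow_mul_cuspForm g (N + 1)
  obtain ⟨D, hD⟩ := exists_bound_latticeSum (a := a) (b := b) (c := 0) (by omega) 1 one_half_pos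
  refine ⟨max 1 (C * D / ε), fun z hz1 hz2 ↦ ?_⟩
  have hz3 : 1 ≤ z.im := (le_max_left _ _).trans hz2
  have hz0 : 0 < z.im := one_pos.trans_le hz3
  have hz4 := (le_max_right _ _).trans hz2
  have hfd : (⟨z, hz0⟩ : ℍ) ∈ ModularGroup.fd := by
    refine ⟨?_, hz1⟩
    simp only [Complex.normSq_apply]
    nlinarith [mul_self_nonneg z.re]
  have h1 := hC _ hfd
  have h2 := hD _ (mem_halfStrip_of_mem_fd hfd)
  rw [extend, UpperHalfPlane.ofComplex_apply_of_im_pos hz0, imPowMulConj, norm_mul, norm_mul,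
    norm_pow, Complex.norm_real, Complex.norm_conj]
  simp only [UpperHalfPlane.im] at h1 h2 ⊢
  rw [Real.norm_of_nonneg hz0.le]
  rw [div_le_iff₀ hε] at hz4
  refine le_of_mul_le_mul_left ?_ hz0
  calc z.im * (z.im ^ N * ‖latticeSum a b 0 z‖ * ‖g ⟨z, hz0⟩‖)
      = (z.im ^ (N + 1) * ‖g ⟨z, hz0⟩‖) * ‖latticeSum a b 0 z‖ := by ring
    _ ≤ C * D := by
        gcongr
        exact (by positivity : 0 ≤ z.im ^ (N + 1) * ‖g ⟨z, hz0⟩‖).trans h1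
    _ ≤ z.im * ε := hz4

lemma setIntegral_imPowMulConj_eq_zero {r s : ℕ} (h : 0 < r + s)
    (g : CuspForm 𝒮ℒ (((r + 1 : ℕ) : ℤ) - s)) :
    ∫ z in ModularGroup.fdo, imPowMulConj (r + 2) (r + 2) (s + 1) g z = 0 := by
  have hD : EqOn (fun p ↦ twoDz (extend (imPowMulConj (r + 1) (r + 1) (s + 2) g)) (fdoChart p))
      (fun p ↦ -Complex.I * (r + 1) *
        densityMul (imPowMulConj (r + 2) (r + 2) (s + 1) g) (fdoChart p))
      (Ioo (-(1 / 2)) (1 / 2) ×ˢ Ioi 0) := fun p hp ↦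
    twoDz_imPowMulConj h g (fdoChart_im_pos (abs_lt.mpr hp.1).le (le_of_lt hp.2))
  have hms : MeasurableSet (Ioo (-(1 / 2)) (1 / 2) ×ˢ Ioi 0 : Set (ℝ × ℝ)) :=
    measurableSet_Ioo.prod measurableSet_Ioi
  have hint := (integrableOn_fdo_iff _).mp (integrableOn_imPowMulConj (r + 2) (a := r + 2)
    (b := s + 1) (by omega) g)
  have key := setIntegral_twoDz_eq_zero (contDiffOn_imPowMulConj (r + 1) (a := r + 1)
    (b := s + 2) (by omega) g) (fun z hz ↦ ?_) (fun z hz ↦ ?_)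
    (fun ε hε ↦ exists_extend_imPowMulConj_le (r + 1) (by omega) g hε)
    ((integrableOn_congr_fun hD hms).mpr (hint.const_mul _))
  · rw [setIntegral_congr_fun hms hD, integral_const_mul, ← setIntegral_fdo_eq] at key
    refine (mul_eq_zero.mp key).resolve_left (mul_ne_zero (by simp) ?_)
    exact_mod_cast r.succ_ne_zero
  · have h1 : ((ModularGroup.T • (⟨z, hz⟩ : ℍ) : ℍ) : ℂ) = z + 1 := by
      rw [coe_smul]; simp [ModularGroup.T]
    have h2 := imPowMulConj_smul (r + 1) s 2 g ModularGroup.T ⟨z, hz⟩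
    rw [extend, extend, ← h1, UpperHalfPlane.ofComplex_apply, h2,
      UpperHalfPlane.ofComplex_apply_of_im_pos hz]
    simp [ModularGroup.T]
  · have h1 : ((ModularGroup.S • (⟨z, hz⟩ : ℍ) : ℍ) : ℂ) = -z⁻¹ := by
      rw [coe_smul]; simp [ModularGroup.S, neg_div]
    have h2 := imPowMulConj_smul (r + 1) s 2 g ModularGroup.S ⟨z, hz⟩
    rw [extend, extend, ← h1, UpperHalfPlane.ofComplex_apply, h2,
      UpperHalfPlane.ofComplex_apply_of_im_pos hz]
    simp [ModularGroup.S]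

lemma pairingIntegrand_eisenstein (r s : ℕ) (g : ℍ → ℂ) : pairingIntegrand r (eisenstein r s) g =
    fun z ↦ (2 * Complex.I * eisensteinConst r s) * imPowMulConj (r + 1) (r + 1) (s + 1) g z := by
  ext z
  rw [pairingIntegrand, eisenstein_eq, imPowMulConj, sub_conj_eq, zpow_natCast,
    UpperHalfPlane.coe_im]
  ring

lemma pairingConverges_eisenstein {r s : ℕ} (h : 0 < r + s) {k : ℤ} (g : CuspForm 𝒮ℒ k) :
    PairingConverges r (eisenstein r s) g := by
  rw [PairingConverges, pairingIntegrand_eisenstein]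
  exact (integrableOn_imPowMulConj _ (by omega) g).const_mul _

lemma cuspForm_eq_zero_of_nonpos {k : ℤ} (hk : k ≤ 0) (g : CuspForm 𝒮ℒ k) : g = 0 :=
  rank_zero_iff_forall_zero.mp (CuspForm.rank_eq_zero_of_weight_lt_twelve (by omega)) g

lemma pairing_eisenstein {r s : ℕ} (h : 0 < r + s) (g : CuspForm 𝒮ℒ ((r : ℤ) - s)) :
    pairing r (eisenstein r s) g = 0 := by
  rw [pairing, pairingIntegrand_eisenstein, integral_const_mul]
  rcases r with _ | r
  · rw [cuspForm_eq_zero_of_nonpos (by simp) g]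
    simp [imPowMulConj]
  -- After the shift of r, the case r = s = 0 is weight 1, where there are no cusp forms.
  · rcases Nat.eq_zero_or_pos (r + s) with h0 | h0
    · obtain ⟨rfl, rfl⟩ : r = 0 ∧ s = 0 := by omega
      have : g = 0 := rank_zero_iff_forall_zero.mp
        (CuspForm.rank_eq_zero_of_weight_lt_twelve (by norm_num)) g
      rw [this]
      simp [imPowMulConj]
    · rw [setIntegral_imPowMulConj_eq_zero h0 g, mul_zero]

/-! ### Positivity of the Petersson product and the two projections -/

instance isOpenPosMeasure_upperHalfPlane : (volume : Measure ℍ).IsOpenPosMeasure where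
  open_pos U hU hne h := by
    rw [UpperHalfPlane.volume_def, withDensity_apply_eq_zero measurable_density.coe_nnreal_ennreal]
      at h
    have h1 : {z : ℍ | (((1 / NNReal.mk z.im z.im_pos.le : NNReal) ^ 2 : NNReal) : ENNReal) ≠ 0} ∩ U
        = U := by
      refine inter_eq_right.mpr fun z _ ↦ ?_
      rw [mem_ofPred_eq, ENNReal.coe_ne_zero]
      exact pow_ne_zero 2 (one_div_ne_zero (NNReal.ne_iff.mp z.im_pos.ne'))
    rw [h1, UpperHalfPlane.measurableEmbedding_coe.comap_apply] at h
    exact (UpperHalfPlane.isOpenEmbedding_coe.isOpenMap U hU).measure_ne_zero volume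
      (hne.image _) h

/-- The continuous nonnegative function |P|² y^k has integral 0 over an open set, hence vanishes
there; the identity theorem at the interior point 2i finishes. -/
lemma eq_zero_of_pairing_self {k : ℤ} (P : CuspForm 𝒮ℒ k) (h : pairing k P P = 0) : P = 0 := by
  have hP : Continuous P := (ModularFormClass.holo P).continuous
  set ψ : ℍ → ℝ := fun z ↦ ‖P z‖ ^ 2 * z.im ^ k with hψ
  have h1 : pairingIntegrand k P P = fun z ↦ (ψ z : ℂ) := by
    ext z
    rw [pairingIntegrand, Complex.mul_conj']
    push_cast [hψ]
    rfl
  have hnn : ∀ z, 0 ≤ ψ z := fun z ↦ mul_nonneg (sq_nonneg _) (zpow_nonneg z.im_pos.le _)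
  have hc : Continuous ψ := (hP.norm.pow 2).mul
    (UpperHalfPlane.continuous_im.zpow₀ k fun z ↦ .inl z.im_pos.ne')
  obtain ⟨C, hC⟩ := CuspFormClass.petersson_bounded_left k 𝒮ℒ P P
  have hi : IntegrableOn (fun z ↦ (ψ z : ℂ)) ModularGroup.fdo := by
    refine integrableOn_fdo_of_bounded (Complex.continuous_ofReal.comp hc) (C := C) fun z _ ↦ ?_
    have h2 := hC z
    rw [UpperHalfPlane.petersson, mul_comm (conj (P z))] at h2
    rw [← congrFun h1 z, pairingIntegrand]
    exact h2
  rw [pairing, h1, integral_complex_ofReal, Complex.ofReal_eq_zero,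
    setIntegral_eq_zero_iff_of_nonneg_ae (ae_of_all _ hnn) (by simpa [IntegrableOn] using hi.re)] at h
  have h2 : EqOn ψ 0 ModularGroup.fdo := Measure.eqOn_open_of_ae_eq h ModularGroup.isOpen_fdo
    hc.continuousOn continuousOn_const
  have hI : (⟨2 * Complex.I, by simp⟩ : ℍ) ∈ ModularGroup.fdo := by
    refine ⟨by norm_num [Complex.normSq_apply], by norm_num [UpperHalfPlane.re]⟩
  refine DFunLike.coe_injective (UpperHalfPlane.eq_zero_of_frequently (ModularFormClass.holo P)
    (τ := ⟨2 * Complex.I, by simp⟩) ?_)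
  have h3 : ∀ᶠ z in 𝓝[≠] (⟨2 * Complex.I, by simp⟩ : ℍ), P z = 0 := by
    filter_upwards [nhdsWithin_le_nhds (ModularGroup.isOpen_fdo.mem_nhds hI)] with z hz
    have h4 := h2 hz
    simpa [hψ, zpow_ne_zero _ z.im_pos.ne'] using h4
  exact h3.frequently

theorem isHolomorphicProjection_eisenstein_iff {r s : ℕ} (h : 0 < r + s)
    (P : CuspForm 𝒮ℒ ((r : ℤ) - s)) :
    IsHolomorphicProjection r s (eisenstein r s) P ↔ P = 0 := by
  constructor
  · intro hP
    refine eq_zero_of_pairing_self P ?_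
    -- Testing the projection against g = P itself gives ⟨P, P⟩ = 0.
    rw [← (hP P).2, pairing_eisenstein h]
  · rintro rfl g
    refine ⟨pairingConverges_eisenstein h g, ?_⟩
    rw [pairing_eisenstein h]
    simp [pairing, pairingIntegrand]

lemma pairingIntegrand_conjFun (n : ℤ) (f g : ℍ → ℂ) :
    pairingIntegrand n (conjFun f) (conjFun g) = fun z ↦ conj (pairingIntegrand n f g z) := by
  ext z
  simp [pairingIntegrand, conjFun]

lemma pairing_conjFun (n : ℤ) (f g : ℍ → ℂ) :
    pairing n (conjFun f) (conjFun g) = conj (pairing n f g) := by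
  rw [pairing, pairing, pairingIntegrand_conjFun, integral_conj]

lemma pairingConverges_conjFun {n : ℤ} {f g : ℍ → ℂ} :
    PairingConverges n (conjFun f) (conjFun g) ↔ PairingConverges n f g := by
  rw [PairingConverges, PairingConverges, pairingIntegrand_conjFun]
  exact Complex.conjCLE.integrable_comp_iff

theorem isAntiholomorphicProjection_eisenstein_iff {r s : ℕ} (h : 0 < r + s)
    (P : CuspForm 𝒮ℒ ((s : ℤ) - r)) :
    IsAntiholomorphicProjection r s (eisenstein r s) P ↔ P = 0 := by
  rw [← isHolomorphicProjection_eisenstein_iff (by omega : 0 < s + r)]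
  have h1 : eisenstein r s = conjFun (eisenstein s r) := by
    ext z
    exact (conj_eisenstein s r z).symm
  rw [IsAntiholomorphicProjection, IsHolomorphicProjection, h1]
  simp only [pairing_conjFun, pairingConverges_conjFun, (starRingEnd ℂ).injective.eq_iff]

end RealAnalyticModular

end

theorem mainTheorem6 (r s : ℕ) (hw : 0 < r + s) :
    (∀ z : ℍ, Summable fun p : {p : ℤ × ℤ // p ≠ (0, 0)} =>
        RealAnalyticModular.eisensteinTerm r s z p) ∧
    RealAnalyticModular.Smooth (RealAnalyticModular.eisenstein r s) ∧
    RealAnalyticModular.IsModularOfWeights r s (RealAnalyticModular.eisenstein r s) ∧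
    (∀ z : ℍ, conj (RealAnalyticModular.eisenstein r s z) =
        RealAnalyticModular.eisenstein s r z) ∧
    (∀ z : ℍ, RealAnalyticModular.laplace r s (RealAnalyticModular.eisenstein r s) z =
        -((r : ℂ) + (s : ℂ)) * RealAnalyticModular.eisenstein r s z) ∧
    (∀ P : CuspForm 𝒮ℒ ((r : ℤ) - (s : ℤ)),
        RealAnalyticModular.IsHolomorphicProjection r s
          (RealAnalyticModular.eisenstein r s) P ↔ P = 0) ∧
    (∀ P : CuspForm 𝒮ℒ ((s : ℤ) - (r : ℤ)),
        RealAnalyticModular.IsAntiholomorphicProjection r s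
          (RealAnalyticModular.eisenstein r s) P ↔ P = 0) := by
  open RealAnalyticModular in
  exact ⟨summable_eisensteinTerm hw, smooth_eisenstein hw, isModularOfWeights_eisenstein r s,
    conj_eisenstein r s, laplace_eisenstein hw, isHolomorphicProjection_eisenstein_iff hw,
    isAntiholomorphicProjection_eisenstein_iff hw⟩
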